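/- **Conventions.** Let $B_n$ be the Artin braid group on $n$ strands with generators $\sigma_1,\dots,\sigma_{n-1}$ and $PB_n$ its subgroup of pure braids; products of braids and of morphisms are read from right to left. Put $x_{12}=\sigma_1^2$ in $PB_2$, $x_{12}=\sigma_1^2$, $x_{23}=\sigma_2^2$, $x_{13}=\sigma_2\sigma_1^2\sigma_2^{-1}$ in $PB_3$, and let $F_2=\langle x,y\rangle\le PB_3$ with $x=x_{12}$, $y=x_{23}$. Let $\mathsf{PaB}^{\le 4}$ be the truncated operad (arities $\le 4$) in groupoids of parenthesized braids: objects of $\mathsf{PaB}(n)$ are completely parenthesized permutations of $1,\dots,n$; morphisms are braids that join equal labels; symmetric groups act by relabelling; $\gamma\circ_i\delta$ replaces the strand of $\gamma$ labelled by $i$ by a thin copy of $\delta$. Let $\beta:12\to 21$ be the morphism with braid $\sigma_1$ and $\alpha:(12)3\to 1(23)$ the one with the trivial braid. For $h\in PB_n$ let $\mathfrak m(h)$ be the automorphism of $(..(12)3..)n$ given by $h$. For an automorphism let $\mathfrak{ou}$ denote its underlying pure braid. Put $$\varphi_{123}(h)=\mathfrak{ou}(\mathrm{id}_{12}\circ_1\mathfrak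 m(h)),\ \varphi_{234}(h)=\mathfrak{ou}(\mathrm{id}_{12}\circ_2\mathfrak m(h)),\ \varphi_{12,3,4}(h),\varphi_{1,23,4}(h),\varphi_{1,2,34}(h)=\mathfrak{ou}(\mathfrak m(h)\circ_p\mathrm{id}_{12})\ (p=1,2,3)$$ for $h\in PB_3$, and similarly $\varphi_{12},\varphi_{23},\varphi_{12,3},\varphi_{1,23}:PB_2\to PB_3$. Let $N$ be a normal subgroup of finite index of $B_4$ with $N\le PB_4$. Put $N_{PB_4}=N$, let $N_{PB_3}$ be the intersection of the preimages of $N$ under the five maps $\varphi:PB_3\to PB_4$ above, $N_{PB_2}$ the intersection of the preimages of $N_{PB_3}$ under the four maps $\varphi:PB_2\to PB_3$, and $N_{PB_1}=1$. Two morphisms $\gamma,\gamma'$ of $\mathsf{PaB}(n)$, $n\le 4$, with the same source and target are equivalent, $\gamma\sim_N\gamma'$, if $\gamma^{-1}\gamma'$ is given by an element of $N_{PB_n}$. The quotient $\mathsf{PaB}^{\le 4}/\!\sim_N$ is again a truncated operad in groupoids. All morphisms of truncated operads below are the identity on objects. The groupoid $\mathsf{GTSh}$ has as objects all such $N$; morphisms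 $\tilde N\to N$ are the isomorphisms of truncated operads $\mathsf{PaB}^{\le4}/\!\sim_{\tilde N}\;\to\;\mathsf{PaB}^{\le4}/\!\sim_N$. For such an isomorphism write $T:\mathsf{PaB}^{\le4}\to\mathsf{PaB}^{\le4}/\!\sim_N$ for its composite with the projection, and $T^{PB_n}:=\mathfrak{ou}\circ T\circ\mathfrak m:PB_n\to PB_n/N_{PB_n}$. The isomorphism is represented by $(m,f)\in\mathbb Z\times PB_3$, and denoted $[(m,f)]$, if $$T(\alpha)=[\alpha\cdot\mathfrak m(f)],\qquad T(\beta)=[\beta\cdot\mathfrak m(x_{12}^m)];$$ then $T$ and $T^{PB_n}$ are written $T_{m,f}$ and $T^{PB_n}_{m,f}$. A pair $(m,f)$ represents an element of $\mathsf{GT}(N)$ (a $\mathsf{GT}$-shadow) if $$\sigma_1x_{12}^mf^{-1}\sigma_2x_{23}^mf\,N_{PB_3}=f^{-1}\sigma_1\sigma_2(x_{13}x_{23})^mN_{PB_3},\qquad f^{-1}\sigma_2x_{23}^mf\sigma_1x_{12}^mN_{PB_3}=\sigma_2\sigma_1(x_{12}x_{13})^mf\,N_{PB_3},$$ $$\varphi_{234}(f)\varphi_{1,23,4}(f)\varphi_{123}(f)N=\varphi_{1,2,34}(f)\varphi_{12,3,4}(f)N,$$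 and, for the morphism $T_{m,f}:\mathsf{PaB}^{\le4}\to\mathsf{PaB}^{\le4}/\!\sim_N$ with the above values on $\alpha$ and $\beta$, the maps $T_{m,f}^{PB_n}$ are onto for $n=2,3,4$. **Proposition.** Let $N^{(1)},N^{(2)},N^{(3)}$ be objects of $\mathsf{GTSh}$, and let $[(m_1,f_1)]:N^{(1)}\to N^{(2)}$ and $[(m_2,f_2)]:N^{(2)}\to N^{(3)}$ be morphisms. Put $m:=2m_1m_2+m_1+m_2$ and let $f\in PB_3$ be any element with $$f\,N^{(3)}_{PB_3}=f_2\,N^{(3)}_{PB_3}\cdot T^{PB_3}_{m_2,f_2}(f_1)\quad\text{in } PB_3/N^{(3)}_{PB_3}.$$ Then the composition $[(m_2,f_2)]\circ[(m_1,f_1)]:N^{(1)}\to N^{(3)}$ is represented by $(m,f)$; moreover, $(m,f)$ represents an element of $\mathsf{GT}(N^{(3)})$, and the kernel of $T^{PB_4}_{m,f}$ is $N^{(1)}$. If $f_1,f_2\in F_2$ (practical $\mathsf{GT}$-shadows), written as words $f_1(x,y)$, $f_2(x,y)$, then the composition is represented by $(m,f)$ with $$m=2m_1m_2+m_1+m_2,\qquad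 f(x,y)=f_2(x,y)\,f_1\big(x^{2m_2+1},\,f_2(x,y)^{-1}y^{2m_2+1}f_2(x,y)\big).$$ -/

import Mathlib

namespace GTS

/-- The defining relations of the Artin braid group on `n` strands, in the generators
`σ_0, …, σ_{n-2}` (numbered from `0`). -/
def braidRels (n : ℕ) : Set (FreeGroup (Fin (n - 1))) :=
  {r | (∃ i j : Fin (n - 1), ((i : ℕ) + 2 ≤ j ∨ (j : ℕ) + 2 ≤ i) ∧
        r = FreeGroup.of i * FreeGroup.of j * (FreeGroup.of i)⁻¹ * (FreeGroup.of j)⁻¹) ∨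
      (∃ i j : Fin (n - 1), (i : ℕ) + 1 = j ∧
        r = FreeGroup.of i * FreeGroup.of j * FreeGroup.of i *
          (FreeGroup.of j)⁻¹ * (FreeGroup.of i)⁻¹ * (FreeGroup.of j)⁻¹)}

/-- The Artin braid group on `n` strands. -/
abbrev B (n : ℕ) : Type := PresentedGroup (braidRels n)

/-- The generator exchanging the strands at the positions `i` and `i + 1` (positions are numbered
from `0`; the strand that starts at position `i` passes over).  It is `1` if there is no such
generator. -/
def sig (n i : ℕ) : B n :=
  if h : i < n - 1 then PresentedGroup.of ⟨i, h⟩ else 1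

lemma sig_comm (n : ℕ) {i j : ℕ} (h : i + 2 ≤ j) : sig n i * sig n j = sig n j * sig n i := by
  unfold sig
  split_ifs with h1 h2 <;> try simp
  have := PresentedGroup.mk_eq_mk_of_mul_inv_mem (rels := braidRels n)
    (x := FreeGroup.of ⟨i, h1⟩ * FreeGroup.of ⟨j, h2⟩)
    (y := FreeGroup.of ⟨j, h2⟩ * FreeGroup.of ⟨i, h1⟩)
    (Or.inl ⟨⟨i, h1⟩, ⟨j, h2⟩, Or.inl h, by group⟩)
  simpa [PresentedGroup.of] using this

lemma sig_braid (n : ℕ) {i : ℕ} (h : i + 2 < n) :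
    sig n i * sig n (i + 1) * sig n i = sig n (i + 1) * sig n i * sig n (i + 1) := by
  have h1 : i < n - 1 := by omega
  have h2 : i + 1 < n - 1 := by omega
  have := PresentedGroup.mk_eq_mk_of_mul_inv_mem (rels := braidRels n)
    (x := FreeGroup.of ⟨i, h1⟩ * FreeGroup.of ⟨i + 1, h2⟩ * FreeGroup.of ⟨i, h1⟩)
    (y := FreeGroup.of ⟨i + 1, h2⟩ * FreeGroup.of ⟨i, h1⟩ * FreeGroup.of ⟨i + 1, h2⟩)
    (Or.inr ⟨⟨i, h1⟩, ⟨i + 1, h2⟩, rfl, by group⟩)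
  simpa [PresentedGroup.of, sig, h1, h2] using this

/-- A homomorphism out of the braid group is given by images of the generators that satisfy the
braid relations. -/
def liftB (n : ℕ) {G : Type*} [Group G] (f : ℕ → G)
    (hc : ∀ i j, i + 2 ≤ j → j + 1 < n → f i * f j = f j * f i)
    (hb : ∀ i, i + 2 < n → f i * f (i + 1) * f i = f (i + 1) * f i * f (i + 1)) : B n →* G :=
  PresentedGroup.toGroup (f := fun i : Fin (n - 1) => f i) (by
    rintro r (⟨i, j, h, rfl⟩ | ⟨i, j, h, rfl⟩)
    · simp only [map_mul, map_inv, FreeGroup.lift_apply_of]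
      rw [mul_inv_eq_one, mul_inv_eq_iff_eq_mul]
      rcases h with h | h
      · exact hc _ _ h (by omega)
      · exact (hc _ _ h (by omega)).symm
    · simp only [map_mul, map_inv, FreeGroup.lift_apply_of]
      rw [mul_inv_eq_one, mul_inv_eq_iff_eq_mul, mul_inv_eq_iff_eq_mul, ← h]
      exact hb _ (by omega))

lemma liftB_sig (n : ℕ) {G : Type*} [Group G] (f : ℕ → G) (hc hb) {i : ℕ} (h : i + 1 < n) :
    liftB n f hc hb (sig n i) = f i := by
  have h1 : i < n - 1 := by omega
  simp [liftB, sig, h1]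

lemma B_induction {n : ℕ} {C : B n → Prop} (h1 : C 1) (hs : ∀ i, i + 1 < n → C (sig n i))
    (hm : ∀ g h, C g → C h → C (g * h)) (hi : ∀ g, C g → C g⁻¹) (g : B n) : C g := by
  induction g using PresentedGroup.induction_on with
  | _ w =>
    induction w using FreeGroup.induction_on with
    | C1 => simpa using h1
    | of i =>
      have := hs i (by omega)
      simpa [sig, PresentedGroup.of] using this
    | inv_of i _ =>
      have := hi _ (hs i (by omega))
      simpa [sig, PresentedGroup.of] using this
    | mul x y hx hy => rw [map_mul]; exact hm _ _ hx hy

/-- The transposition of the positions `i` and `i + 1`. -/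
def tr (n i : ℕ) : Equiv.Perm (Fin n) :=
  if h : i + 1 < n then Equiv.swap ⟨i, by omega⟩ ⟨i + 1, h⟩ else 1

lemma tr_val (n i : ℕ) (h : i + 1 < n) (p : Fin n) :
    ((tr n i p : Fin n) : ℕ) = if (p : ℕ) = i then i + 1 else if (p : ℕ) = i + 1 then i else p := by
  simp only [tr, h, dite_true, Equiv.swap_apply_def, Fin.ext_iff]
  split_ifs <;> rfl

lemma tr_comm (n : ℕ) {i j : ℕ} (h : i + 2 ≤ j) (hj : j + 1 < n) :
    tr n i * tr n j = tr n j * tr n i := by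
  ext p
  simp only [Equiv.Perm.mul_apply, tr_val n i (by omega), tr_val n j hj]
  grind

lemma tr_braid (n : ℕ) {i : ℕ} (h : i + 2 < n) :
    tr n i * tr n (i + 1) * tr n i = tr n (i + 1) * tr n i * tr n (i + 1) := by
  ext p
  simp only [Equiv.Perm.mul_apply, tr_val n i (by omega), tr_val n (i + 1) (by omega)]
  grind

lemma tr_inv (n i : ℕ) : (tr n i)⁻¹ = tr n i := by
  unfold tr
  split_ifs <;> simp

/-- The standard homomorphism to the symmetric group: the strand of `g` that starts at the
position `p` ends at the position `rho n g p`. Products are read from right to left: in `g * h`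
the braid `h` comes first. -/
def rho (n : ℕ) : B n →* Equiv.Perm (Fin n) :=
  liftB n (tr n) (fun _ _ h hj => tr_comm n h hj) (fun _ h => tr_braid n h)

lemma rho_sig {n i : ℕ} (h : i + 1 < n) : rho n (sig n i) = tr n i := liftB_sig _ _ _ _ h

/-- The pure braid group. -/
def PB (n : ℕ) : Subgroup (B n) := (rho n).ker

lemma rho_pure {n : ℕ} (h : PB n) : rho n h = 1 := h.2

/-- The braid obtained from the generator exchanging the positions `i`, `i + 1` by doubling the
strand that *ends* at the position `q`. -/
def dblGen (n i q : ℕ) : B (n + 1) :=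
  if q < i then sig (n + 1) (i + 1)
  else if q = i then sig (n + 1) (i + 1) * sig (n + 1) i
  else if q = i + 1 then sig (n + 1) i * sig (n + 1) (i + 1)
  else sig (n + 1) i

lemma dblGen_lt {n i k : ℕ} (h : k < i) : dblGen n i k = sig (n + 1) (i + 1) := if_pos h

lemma dblGen_self (n i : ℕ) : dblGen n i i = sig (n + 1) (i + 1) * sig (n + 1) i := by
  simp [dblGen]

lemma dblGen_succ (n i : ℕ) : dblGen n i (i + 1) = sig (n + 1) i * sig (n + 1) (i + 1) := by
  simp [dblGen]

lemma dblGen_gt {n i k : ℕ} (h : i + 1 < k) : dblGen n i k = sig (n + 1) i := by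
  simp [dblGen, show ¬ k < i by omega, show k ≠ i by omega, show k ≠ i + 1 by omega]

lemma dblGen_comm (n : ℕ) {i j : ℕ} (h : i + 2 ≤ j) (hj : j + 1 < n) (q : Fin n) :
    dblGen n i q * dblGen n j (tr n i q : Fin n) =
      dblGen n j q * dblGen n i (tr n j q : Fin n) := by
  rw [tr_val n i (by omega), tr_val n j hj]
  have c1 := sig_comm (n + 1) h
  have c2 := sig_comm (n + 1) (show i + 2 ≤ j + 1 by omega)
  generalize (q : ℕ) = k
  rcases lt_or_ge k (i + 2) with h1 | h1
  · have c3 := sig_comm (n + 1) (show i + 1 + 2 ≤ j + 1 by omega)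
    rw [if_neg (show k ≠ j by omega), if_neg (show k ≠ j + 1 by omega), dblGen_lt (i := j),
      dblGen_lt (i := j) (by omega)]
    · unfold dblGen
      split_ifs
      exacts [c3, Commute.mul_left c3 c2, Commute.mul_left c2 c3, c2]
    · split_ifs <;> omega
  · rw [if_neg (show k ≠ i by omega), if_neg (show k ≠ i + 1 by omega), dblGen_gt (i := i) (by omega),
      dblGen_gt (i := i)]
    · unfold dblGen
      split_ifs
      exacts [c2, Commute.mul_right c2 c1, Commute.mul_right c1 c2, c1]
    · split_ifs <;> omega

lemma braid_aux {G : Type*} [Group G] {x y z : G} (b1 : x * y * x = y * x * y)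
    (b2 : y * z * y = z * y * z) (c : x * z = z * x) :
    y * x * (z * y) * x = z * (y * x) * (z * y) ∧ x * y * z * (y * x) = z * y * x * (y * z) ∧
      x * (y * z) * (x * y) = y * z * (x * y) * z := by
  refine ⟨?_, ?_, ?_⟩
  · calc y * x * (z * y) * x = y * (x * z) * (y * x) := by simp only [mul_assoc]
      _ = y * z * (x * y * x) := by rw [c]; simp only [mul_assoc]
      _ = (y * z * y) * (x * y) := by rw [b1]; simp only [mul_assoc]
      _ = z * y * (z * x) * y := by rw [b2]; simp only [mul_assoc]
      _ = z * (y * x) * (z * y) := by rw [← c]; simp only [mul_assoc]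
  · calc x * y * z * (y * x) = x * (y * z * y) * x := by simp only [mul_assoc]
      _ = (x * z) * y * (z * x) := by rw [b2]; simp only [mul_assoc]
      _ = z * (x * y * x) * z := by rw [← c]; nth_rw 1 [c]; simp only [mul_assoc]
      _ = z * y * x * (y * z) := by rw [b1]; simp only [mul_assoc]
  · calc x * (y * z) * (x * y) = x * y * (z * x) * y := by simp only [mul_assoc]
      _ = (x * y * x) * z * y := by rw [← c]; simp only [mul_assoc]
      _ = y * x * (y * z * y) := by rw [b1]; simp only [mul_assoc]
      _ = y * (x * z) * y * z := by rw [b2]; simp only [mul_assoc]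
      _ = y * z * (x * y) * z := by rw [c]; simp only [mul_assoc]

lemma dblGen_braid (n : ℕ) {i : ℕ} (h : i + 2 < n) (q : Fin n) :
    dblGen n i q * dblGen n (i + 1) (tr n i q : Fin n) *
        dblGen n i (tr n (i + 1) (tr n i q) : Fin n) =
      dblGen n (i + 1) q * dblGen n i (tr n (i + 1) q : Fin n) *
        dblGen n (i + 1) (tr n i (tr n (i + 1) q) : Fin n) := by
  have b1 := sig_braid (n + 1) (show i + 2 < n + 1 by omega)
  have b2 := sig_braid (n + 1) (show i + 1 + 2 < n + 1 by omega)
  have c1 := sig_comm (n + 1) (show i + 2 ≤ i + 1 + 1 by omega)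
  simp only [tr_val n i (by omega : i + 1 < n), tr_val n (i + 1) (by omega : i + 1 + 1 < n)]
  generalize (q : ℕ) = k
  rcases lt_trichotomy k i with h2 | rfl | h2
  · simp only [show k ≠ i by omega, show k ≠ i + 1 by omega, show k ≠ i + 1 + 1 by omega, if_false,
      dblGen_lt h2, dblGen_lt (show k < i + 1 by omega)]
    exact b2
  · simp only [if_true, show k ≠ k + 1 by omega, show k ≠ k + 1 + 1 by omega, if_false,
      dblGen_self, dblGen_lt (show k < k + 1 by omega),
      dblGen_gt (show k + 1 < k + 1 + 1 by omega)]
    generalize sig (n + 1) k = x at *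
    generalize sig (n + 1) (k + 1) = y at *
    generalize sig (n + 1) (k + 1 + 1) = z at *
    clear h
    exact (braid_aux b1 b2 c1).1
  · rcases eq_or_ne k (i + 1) with rfl | h3
    · simp only [if_true, show i ≠ i + 1 by omega, show i + 1 ≠ i by omega,
        show i + 1 + 1 ≠ i by omega, show i + 1 + 1 ≠ i + 1 by omega,
        show i ≠ i + 1 + 1 by omega, if_false,
        dblGen_self, dblGen_succ, dblGen_lt (show i < i + 1 by omega),
        dblGen_gt (show i + 1 < i + 1 + 1 by omega)]
      generalize sig (n + 1) i = x at *
      generalize sig (n + 1) (i + 1) = y at *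
      generalize sig (n + 1) (i + 1 + 1) = z at *
      clear h
      exact (braid_aux b1 b2 c1).2.1
    · rcases eq_or_ne k (i + 1 + 1) with rfl | h4
      · simp only [if_true, show i + 1 ≠ i by omega,
          show i + 1 + 1 ≠ i by omega, show i + 1 + 1 ≠ i + 1 by omega, if_false,
          dblGen_succ, dblGen_lt (show i < i + 1 by omega),
          dblGen_gt (show i + 1 < i + 1 + 1 by omega)]
        generalize sig (n + 1) i = x at *
        generalize sig (n + 1) (i + 1) = y at *
        generalize sig (n + 1) (i + 1 + 1) = z at *
        clear h
        exact (braid_aux b1 b2 c1).2.2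
      · simp only [show k ≠ i by omega, h3, h4, if_false,
          dblGen_gt (show i + 1 < k by omega), dblGen_gt (show i + 1 + 1 < k by omega)]
        exact b1

lemma mulAutArrow_val {A G : Type*} [Group G] (π : Equiv.Perm A) (F : A → G) (q : A) :
    (mulAutArrow π F : A → G) q = F (π⁻¹ q) := rfl

/-- All doublings of a braid at once: `(dblHom n g).left q` is the braid obtained from `g` by
doubling the strand that ends at the position `q`.  The semidirect product expresses the rule
for doubling a product: one doubles the same strand in both factors. -/
def dblHom (n : ℕ) :
    B n →* (Fin n → B (n + 1)) ⋊[mulAutArrow] Equiv.Perm (Fin n) :=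
  liftB n (fun i => ⟨fun q => dblGen n i q, tr n i⟩)
    (by
      intro i j h hj
      refine SemidirectProduct.ext (funext fun q => ?_) (tr_comm n h hj)
      have := dblGen_comm n h hj q
      simpa [SemidirectProduct.mul_left, mulAutArrow_val, -mulAutArrow_apply_apply, tr_inv] using this)
    (by
      intro i h
      refine SemidirectProduct.ext (funext fun q => ?_) (tr_braid n h)
      have := dblGen_braid n h q
      simpa [SemidirectProduct.mul_left, mulAutArrow_val, -mulAutArrow_apply_apply, tr_inv] using this)

lemma dblHom_right (n : ℕ) (g : B n) : (dblHom n g).right = rho n g := by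
  have : (SemidirectProduct.rightHom.comp (dblHom n)) = rho n := by
    apply PresentedGroup.ext
    intro i
    have h : (i : ℕ) + 1 < n := by omega
    have e : (PresentedGroup.of i : B n) = sig n i := by simp [sig]
    rw [e, rho_sig h, MonoidHom.comp_apply, dblHom, liftB_sig _ _ _ _ h]
    rfl
  exact DFunLike.congr_fun this g

/-- The braid obtained from `g` by doubling the strand that starts at the position `p`. -/
def dbl {n : ℕ} (g : B n) (p : Fin n) : B (n + 1) := (dblHom n g).left (rho n g p)

lemma dbl_mul {n : ℕ} (g h : B n) (p : Fin n) :
    dbl (g * h) p = dbl g (rho n h p) * dbl h p := by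
  simp [dbl, SemidirectProduct.mul_left, mulAutArrow_val, -mulAutArrow_apply_apply, dblHom_right]

lemma dbl_sig {n i : ℕ} (h : i + 1 < n) (p : Fin n) :
    dbl (sig n i) p = dblGen n i (tr n i p : Fin n) := by
  rw [dbl, rho_sig h, dblHom, liftB_sig _ _ _ _ h]

lemma dbl_one {n : ℕ} (p : Fin n) : dbl (1 : B n) p = 1 := by simp [dbl]

lemma dbl_inv {n : ℕ} (g : B n) (p : Fin n) :
    dbl g⁻¹ p = (dbl g ((rho n g)⁻¹ p))⁻¹ := by
  have := dbl_mul g g⁻¹ p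
  rw [mul_inv_cancel, dbl_one, map_inv] at this
  exact (inv_eq_of_mul_eq_one_right this.symm).symm

/-- The position in `Fin (n + m)` of the strand `j ≠ p` after the strand at position `p` has been
replaced by `m + 1` parallel strands. -/
def outer {n : ℕ} (m : ℕ) (p j : Fin n) : Fin (n + m) :=
  if (j : ℕ) < p then ⟨j, by omega⟩ else ⟨j + m, by omega⟩

/-- The position in `Fin (n + m)` of the `k`-th strand of the block of `m + 1` parallel strands
that replaces the strand at position `p`. -/
def inner {n m : ℕ} (p : Fin n) (k : Fin (m + 1)) : Fin (n + m) := ⟨p + k, by omega⟩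

lemma outer_val {n : ℕ} (m : ℕ) (p j : Fin n) :
    (outer m p j : ℕ) = if (j : ℕ) < p then (j : ℕ) else j + m := by
  unfold outer
  split_ifs <;> rfl

lemma inner_val {n m : ℕ} (p : Fin n) (k : Fin (m + 1)) : (inner p k : ℕ) = p + k := rfl

/-- Replacing the element `p` of `Fin n` by a block of `m + 1` consecutive elements. -/
def block {n : ℕ} (m : ℕ) (p : Fin n) : {j : Fin n // j ≠ p} ⊕ Fin (m + 1) ≃ Fin (n + m) where
  toFun := Sum.elim (fun j => outer m p j) (fun k => inner p k)
  invFun x :=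
    if h : (x : ℕ) < p then Sum.inl ⟨⟨x, by omega⟩, by rw [Ne, Fin.ext_iff]; simp; omega⟩
    else if h' : (x : ℕ) ≤ p + m then Sum.inr ⟨x - p, by omega⟩
    else Sum.inl ⟨⟨x - m, by omega⟩, by rw [Ne, Fin.ext_iff]; simp; omega⟩
  left_inv := by
    rintro (⟨j, hj⟩ | k)
    · rw [Ne, Fin.ext_iff] at hj
      simp only [Sum.elim_inl, outer_val]
      rcases lt_or_ge (j : ℕ) p with h | h
      · simp [h]
      · simp only [show ¬ (j : ℕ) < p by omega, if_false, show ¬ (j : ℕ) + m < p by omega,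
          dif_neg, not_false_eq_true, show ¬ (j : ℕ) + m ≤ p + m by omega]
        simp
    · simp [inner_val, show (k : ℕ) ≤ m by omega]
  right_inv := by
    intro x
    ext
    dsimp only
    split_ifs with h h' <;> simp [outer_val, inner_val] <;> grind

/-- How the permutation of a braid changes when the strand that starts at `p` is replaced by
`m + 1` parallel strands. -/
def IsCabled {n : ℕ} (m : ℕ) (p : Fin n) (π : Equiv.Perm (Fin n)) (π' : Equiv.Perm (Fin (n + m))) :
    Prop :=
  (∀ j, j ≠ p → π' (outer m p j) = outer m (π p) (π j)) ∧
    ∀ k : Fin (m + 1), π' (inner p k) = inner (π p) k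

lemma isCabled_dbl {n : ℕ} (g : B n) (p : Fin n) : IsCabled 1 p (rho n g) (rho (n + 1) (dbl g p)) := by
  induction g using B_induction generalizing p with
  | h1 => simp [IsCabled, dbl_one]
  | hs i hi =>
    have e1 : ∀ x, _ := tr_val (n + 1) i (by omega)
    have e2 : ∀ x, _ := tr_val (n + 1) (i + 1) (by omega)
    have t : ∀ x, _ := tr_val n i hi
    have r1 := rho_sig (n := n + 1) (i := i) (by omega)
    have r2 := rho_sig (n := n + 1) (i := i + 1) (by omega)
    rw [dbl_sig hi, rho_sig hi, t]
    have hc : (p : ℕ) < i ∨ (p : ℕ) = i ∨ (p : ℕ) = i + 1 ∨ i + 1 < (p : ℕ) := by omega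
    refine ⟨fun j hj => ?_, fun k => ?_⟩
    · rw [Ne, Fin.ext_iff] at hj
      rw [Fin.ext_iff, outer_val]
      rcases hc with h | h | h | h
      · have tp : ((tr n i p : Fin n) : ℕ) = p := by rw [t]; split_ifs <;> omega
        rw [← t, tp, dblGen_lt h, r2, e2, outer_val, t]
        split_ifs <;> omega
      · have tp : ((tr n i p : Fin n) : ℕ) = i + 1 := by rw [t]; split_ifs; rfl
        rw [← t, tp, dblGen_succ, map_mul, r1, r2, Equiv.Perm.mul_apply, e1, e2, outer_val, t]
        clear t e1 e2 r1 r2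
        rcases lt_or_ge (j : ℕ) p with h' | h'
        · rw [if_pos h']; split_ifs <;> omega
        · rw [if_neg (not_lt.2 h')]; split_ifs <;> omega
      · have tp : ((tr n i p : Fin n) : ℕ) = i := by rw [t]; split_ifs <;> omega
        rw [← t, tp, dblGen_self, map_mul, r1, r2, Equiv.Perm.mul_apply, e2, e1, outer_val, t]
        clear t e1 e2 r1 r2
        rcases lt_or_ge (j : ℕ) p with h' | h'
        · rw [if_pos h']; split_ifs <;> omega
        · rw [if_neg (not_lt.2 h')]; split_ifs <;> omega
      · have tp : ((tr n i p : Fin n) : ℕ) = p := by rw [t]; split_ifs <;> omega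
        rw [← t, tp, dblGen_gt h, r1, e1, outer_val, t]
        split_ifs <;> omega
    · rw [Fin.ext_iff, inner_val]
      have hk : (k : ℕ) = 0 ∨ (k : ℕ) = 1 := by omega
      rcases hc with h | h | h | h
      · have tp : ((tr n i p : Fin n) : ℕ) = p := by rw [t]; split_ifs <;> omega
        rw [← t, tp, dblGen_lt h, r2, e2, inner_val]
        split_ifs <;> omega
      · have tp : ((tr n i p : Fin n) : ℕ) = i + 1 := by rw [t]; split_ifs; rfl
        rw [← t, tp, dblGen_succ, map_mul, r1, r2, Equiv.Perm.mul_apply, e1, e2, inner_val]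
        clear t e1 e2 r1 r2
        rcases hk with hk | hk <;> rw [hk] <;> split_ifs <;> omega
      · have tp : ((tr n i p : Fin n) : ℕ) = i := by rw [t]; split_ifs <;> omega
        rw [← t, tp, dblGen_self, map_mul, r1, r2, Equiv.Perm.mul_apply, e2, e1, inner_val]
        clear t e1 e2 r1 r2
        rcases hk with hk | hk <;> rw [hk] <;> split_ifs <;> omega
      · have tp : ((tr n i p : Fin n) : ℕ) = p := by rw [t]; split_ifs <;> omega
        rw [← t, tp, dblGen_gt h, r1, e1, inner_val]
        split_ifs <;> omega
  | hm g h hg hh =>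
    rw [dbl_mul, map_mul, map_mul]
    refine ⟨fun j hj => ?_, fun k => ?_⟩
    · simp only [Equiv.Perm.mul_apply]
      rw [(hh p).1 j hj, (hg _).1 _ (by simpa using hj)]
    · simp only [Equiv.Perm.mul_apply]
      rw [(hh p).2, (hg _).2]
  | hi g hg =>
    rw [dbl_inv, map_inv, map_inv]
    have := hg ((rho n g)⁻¹ p)
    refine ⟨fun j hj => ?_, fun k => ?_⟩
    · rw [Equiv.Perm.inv_eq_iff_eq, this.1]
      · simp
      · simpa using hj
    · rw [Equiv.Perm.inv_eq_iff_eq, this.2]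
      simp

/-- The braid obtained from `g` by replacing the strand that starts at the position `p` by `m + 1`
parallel strands. -/
def cable {n : ℕ} (g : B n) (p : Fin n) : (m : ℕ) → B (n + m)
  | 0 => g
  | m + 1 => dbl (cable g p m) (inner p 0)

lemma outer_zero {n : ℕ} (p j : Fin n) : outer 0 p j = j := by
  ext
  simp [outer_val]

lemma inner_zero {n : ℕ} (p : Fin n) (k : Fin (0 + 1)) : inner p k = p := by
  ext
  simp [inner_val]

lemma outer_succ {n : ℕ} (m : ℕ) {p j : Fin n} (hj : j ≠ p) :
    outer m p j ≠ inner p 0 ∧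
      (outer (m + 1) p j : Fin (n + m + 1)) = outer 1 (inner p 0) (outer m p j) := by
  rw [Ne, Fin.ext_iff] at hj
  constructor
  · rw [Ne, Fin.ext_iff, inner_val, outer_val, Fin.val_zero]
    split_ifs <;> omega
  · ext
    rw [outer_val 1, outer_val, outer_val, inner_val, Fin.val_zero]
    split_ifs <;> omega

lemma inner_succ_lt {n m : ℕ} (p : Fin n) (k : Fin (m + 1 + 1)) (hk : (k : ℕ) < 1 + 1) :
    inner (n := n) (m := m + 1) p k =
      inner (n := n + m) (m := 1) (inner (m := m) p 0) ⟨k, hk⟩ := by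
  ext
  simp [inner_val]

lemma inner_succ_ge {n m : ℕ} (p : Fin n) (k : Fin (m + 1 + 1)) (hk : 1 + 1 ≤ (k : ℕ)) :
    inner (n := n) (m := m) p ⟨k - 1, by omega⟩ ≠ inner p 0 ∧
      inner (n := n) (m := m + 1) p k =
        outer (n := n + m) 1 (inner (m := m) p 0) (inner (m := m) p ⟨k - 1, by omega⟩) := by
  constructor
  · rw [Ne, Fin.ext_iff, inner_val, inner_val, Fin.val_zero]
    dsimp only
    omega
  · ext
    rw [outer_val, inner_val, inner_val, inner_val, Fin.val_zero]
    dsimp only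
    split_ifs <;> omega

lemma isCabled_cable {n : ℕ} (g : B n) (p : Fin n) (m : ℕ) :
    IsCabled m p (rho n g) (rho (n + m) (cable g p m)) := by
  induction m with
  | zero => exact ⟨fun j _ => by rw [outer_zero, outer_zero]; rfl,
      fun k => by rw [inner_zero, inner_zero]; rfl⟩
  | succ m ih =>
    have h := isCabled_dbl (cable g p m) (inner p 0)
    rw [IsCabled, ih.2 0] at h
    refine ⟨fun j hj => ?_, fun k => ?_⟩
    · have := h.1 (outer m p j) (outer_succ m hj).1
      rw [ih.1 j hj, ← (outer_succ m hj).2,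
        ← (outer_succ m (fun e => hj ((rho n g).injective e))).2] at this
      exact this
    · rcases Nat.lt_or_ge k (1 + 1) with hk | hk
      · have := h.2 ⟨k, hk⟩
        rw [← inner_succ_lt p k hk, ← inner_succ_lt (rho n g p) k hk] at this
        exact this
      · have := h.1 (inner p ⟨k - 1, by omega⟩) (inner_succ_ge p k hk).1
        rw [ih.2, ← (inner_succ_ge p k hk).2, ← (inner_succ_ge (rho n g p) k hk).2] at this
        exact this

lemma cable_one {n : ℕ} (p : Fin n) (m : ℕ) : cable (1 : B n) p m = 1 := by
  induction m with
  | zero => rfl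
  | succ m ih => rw [cable, ih, dbl_one]

lemma cable_mul {n : ℕ} (g h : B n) (p : Fin n) (m : ℕ) :
    cable (g * h) p m = cable g (rho n h p) m * cable h p m := by
  induction m with
  | zero => rfl
  | succ m ih =>
    rw [cable, ih, dbl_mul]
    exact congrArg (fun q => dbl (cable g (rho n h p) m) q * dbl (cable h p m) (inner p 0))
      ((isCabled_cable h p m).2 0)

/-- The homomorphism that lets a braid on `m + 1` strands act on the positions `p, …, p + m` among
`n + m` strands, where all other strands go straight up. -/
def place {n m : ℕ} (p : Fin n) : B (m + 1) →* B (n + m) :=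
  liftB (m + 1) (fun k => sig (n + m) (p + k))
    (fun i j h _ => sig_comm _ (by omega))
    (fun i h => sig_braid (n + m) (i := p + i) (by omega))

lemma place_sig {n m : ℕ} (p : Fin n) {k : ℕ} (h : k + 1 < m + 1) :
    place p (sig (m + 1) k) = sig (n + m) (p + k) := liftB_sig _ _ _ _ h

lemma rho_place {n m : ℕ} (p : Fin n) (g : B (m + 1)) :
    (∀ j, j ≠ p → rho (n + m) (place p g) (outer m p j) = outer m p j) ∧
      ∀ k : Fin (m + 1), rho (n + m) (place p g) (inner p k) = inner p (rho (m + 1) g k) := by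
  induction g using B_induction with
  | h1 => simp
  | hs i hi =>
    have e : ∀ x, _ := tr_val (n + m) (p + i) (by omega)
    rw [place_sig p hi, rho_sig hi, rho_sig (by omega)]
    refine ⟨fun j hj => ?_, fun k => ?_⟩
    · rw [Ne, Fin.ext_iff] at hj
      rw [Fin.ext_iff, e, outer_val]
      split_ifs <;> omega
    · rw [Fin.ext_iff, e, inner_val, inner_val, tr_val _ _ hi]
      split_ifs <;> omega
  | hm g h hg hh =>
    refine ⟨fun j hj => ?_, fun k => ?_⟩
    · rw [map_mul, map_mul, Equiv.Perm.mul_apply, hh.1 j hj, hg.1 j hj]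
    · rw [map_mul, map_mul, Equiv.Perm.mul_apply, hh.2, hg.2, map_mul, Equiv.Perm.mul_apply]
  | hi g hg =>
    refine ⟨fun j hj => ?_, fun k => ?_⟩
    · rw [map_inv, map_inv, Equiv.Perm.inv_eq_iff_eq, hg.1 j hj]
    · rw [map_inv, map_inv, Equiv.Perm.inv_eq_iff_eq, hg.2, map_inv]
      simp


/-! ### The groupoids `PaB(n)` and the operad structure -/

/-- Replace the leaf at position `p` (counted from `0`, from left to right) of the parenthesization
`t` by the parenthesization `s`. -/
def graft : FreeMagma Unit → ℕ → FreeMagma Unit → FreeMagma Unit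
  | .of _, _, s => s
  | .mul l r, p, s =>
    if p < l.length then .mul (graft l p s) r else .mul l (graft r (p - l.length) s)

lemma length_graft (t s : FreeMagma Unit) :
    ∀ p, p < t.length → (graft t p s).length + 1 = t.length + s.length := by
  induction t with
  | ih1 _ =>
    intro p _
    simp [graft, FreeMagma.length, add_comm]
  | ih2 l r hl hr =>
    intro p hp
    change p < l.length + r.length at hp
    change (if p < l.length then FreeMagma.mul (graft l p s) r
      else FreeMagma.mul l (graft r (p - l.length) s)).length + 1 = l.length + r.length + s.length
    split_ifs with h
    · have := hl p h
      change (graft l p s).length + r.length + 1 = _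
      omega
    · have := hr (p - l.length) (by omega)
      change l.length + (graft r (p - l.length) s).length + 1 = _
      omega

/-- An object of `PaB(n)`: a parenthesization of a sequence `(perm 0, …, perm (n-1))`, where `perm`
is a permutation of the labels `0, …, n-1`.  The parenthesization is an element of length `n` of
the free magma on one generator; `perm` sends positions to labels.  There is no object with
`n = 0`. -/
structure Ob (n : ℕ) where
  shape : FreeMagma Unit
  length_shape : shape.length = n
  perm : Equiv.Perm (Fin n)

/-- The action of the symmetric group on objects, by relabelling. -/
def Ob.act {n : ℕ} (θ : Equiv.Perm (Fin n)) (a : Ob n) : Ob n where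
  shape := a.shape
  length_shape := a.length_shape
  perm := θ * a.perm

/-- The sequence of labels `(τ, i) ↦ τ ∘_i σ`: the label `i` of `τ` is replaced by the sequence
`i + σ(0), …, i + σ(m)`, and the labels of `τ` greater than `i` are increased by `m`. -/
def insPerm {n m : ℕ} (τ : Equiv.Perm (Fin n)) (i : Fin n) (σ : Equiv.Perm (Fin (m + 1))) :
    Equiv.Perm (Fin (n + m)) :=
  ((block m (τ⁻¹ i)).symm.trans
    (Equiv.sumCongr (τ.subtypeEquiv (fun _ => not_congr Equiv.Perm.eq_inv_iff_eq)) σ)).trans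
      (block m i)

lemma insPerm_outer {n m : ℕ} (τ : Equiv.Perm (Fin n)) (i : Fin n) (σ : Equiv.Perm (Fin (m + 1)))
    {j : Fin n} (hj : j ≠ τ⁻¹ i) : insPerm τ i σ (outer m (τ⁻¹ i) j) = outer m i (τ j) := by
  have : (block m (τ⁻¹ i)).symm (outer m (τ⁻¹ i) j) = Sum.inl ⟨j, hj⟩ := by
    rw [Equiv.symm_apply_eq]; rfl
  simp only [insPerm, Equiv.trans_apply, this]
  rfl

lemma insPerm_inner {n m : ℕ} (τ : Equiv.Perm (Fin n)) (i : Fin n) (σ : Equiv.Perm (Fin (m + 1)))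
    (k : Fin (m + 1)) : insPerm τ i σ (inner (τ⁻¹ i) k) = inner i (σ k) := by
  have : (block m (τ⁻¹ i)).symm (inner (τ⁻¹ i) k) = Sum.inr k := by
    rw [Equiv.symm_apply_eq]; rfl
  simp only [insPerm, Equiv.trans_apply, this]
  rfl

lemma exists_outer_or_inner {n : ℕ} (m : ℕ) (p : Fin n) (x : Fin (n + m)) :
    (∃ j, j ≠ p ∧ x = outer m p j) ∨ ∃ k : Fin (m + 1), x = inner p k := by
  obtain ⟨y, rfl⟩ := (block m p).surjective x
  rcases y with ⟨j, hj⟩ | k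
  · exact Or.inl ⟨j, hj, rfl⟩
  · exact Or.inr ⟨k, rfl⟩

/-- The elementary insertion `a ∘_i b` of objects: the leaf of `a` labelled by `i` is replaced
by `b`. -/
def Ob.ins {n m : ℕ} (a : Ob n) (i : Fin n) (b : Ob (m + 1)) : Ob (n + m) where
  shape := graft a.shape (a.perm⁻¹ i : Fin n) b.shape
  length_shape := by
    have h := length_graft a.shape b.shape (a.perm⁻¹ i : Fin n)
      (by rw [a.length_shape]; exact (a.perm⁻¹ i).2)
    rw [a.length_shape, b.length_shape] at h
    omega
  perm := insPerm a.perm i b.perm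

/-- A morphism of `PaB(n)` from `a` to `b`: a braid whose strand that starts at the label `i` of
`a` ends at the label `i` of `b`, for all `i`. -/
@[ext]
structure Hom {n : ℕ} (a b : Ob n) where
  braid : B n
  rho_braid : rho n braid = b.perm⁻¹ * a.perm

/-- The identity morphism. -/
def Hom.id {n : ℕ} (a : Ob n) : Hom a a := ⟨1, by simp⟩

/-- The composition `γ · η` (first `η`, then `γ`). -/
def Hom.comp {n : ℕ} {a b c : Ob n} (γ : Hom b c) (η : Hom a b) : Hom a c :=
  ⟨γ.braid * η.braid, by rw [map_mul, γ.rho_braid, η.rho_braid]; group⟩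

/-- The action of the symmetric group on morphisms: the braid does not change. -/
def Hom.act {n : ℕ} (θ : Equiv.Perm (Fin n)) {a b : Ob n} (γ : Hom a b) :
    Hom (a.act θ) (b.act θ) :=
  ⟨γ.braid, by rw [γ.rho_braid]; simp [Ob.act, mul_assoc]⟩

/-- The elementary insertion `γ ∘_i δ` of morphisms: the strand of `γ` that originates at the
position labelled by `i` is replaced by a thin version of `δ`. -/
def Hom.ins {n m : ℕ} {a a' : Ob n} {b b' : Ob (m + 1)} (γ : Hom a a') (i : Fin n)
    (δ : Hom b b') : Hom (a.ins i b) (a'.ins i b') where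
  braid := cable γ.braid (a.perm⁻¹ i) m * place (a.perm⁻¹ i) δ.braid
  rho_braid := by
    have hp : rho n γ.braid (a.perm⁻¹ i) = a'.perm⁻¹ i := by simp [γ.rho_braid]
    have hc := isCabled_cable γ.braid (a.perm⁻¹ i) m
    have hq := rho_place (a.perm⁻¹ i) δ.braid
    rw [IsCabled, hp] at hc
    ext1 x
    rw [eq_comm, Equiv.Perm.mul_apply, Equiv.Perm.inv_eq_iff_eq, map_mul, Equiv.Perm.mul_apply]
    change insPerm a.perm i b.perm x = insPerm a'.perm i b'.perm _
    rcases exists_outer_or_inner m (a.perm⁻¹ i) x with ⟨j, hj, rfl⟩ | ⟨k, rfl⟩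
    · rw [hq.1 j hj, hc.1 j hj, insPerm_outer _ _ _ hj, insPerm_outer, γ.rho_braid]
      · simp
      · rw [← hp]; simpa using hj
    · rw [hq.2, hc.2, insPerm_inner, insPerm_inner, δ.rho_braid]
      simp

/-! ### Compatible equivalence relations and quotients of the truncated operad -/

/-- A compatible equivalence relation on the morphisms of the truncated operad `PaB^{≤ 4}`: only
morphisms with the same source and the same target are compared, and the relation is compatible
with the composition, the action of the symmetric groups and the elementary insertions. -/
structure CompatRel where
  r : ∀ {n : ℕ} (_ : n ≤ 4) (a b : Ob n), Setoid (Hom a b)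
  comp : ∀ {n : ℕ} (hn : n ≤ 4) {a b c : Ob n} {γ γ' : Hom b c} {η η' : Hom a b},
    (r hn b c).r γ γ' → (r hn a b).r η η' → (r hn a c).r (γ.comp η) (γ'.comp η')
  act : ∀ {n : ℕ} (hn : n ≤ 4) (θ : Equiv.Perm (Fin n)) {a b : Ob n} {γ γ' : Hom a b},
    (r hn a b).r γ γ' ↔ (r hn _ _).r (γ.act θ) (γ'.act θ)
  ins_left : ∀ {n m : ℕ} (hn : n ≤ 4) (hnm : n + m ≤ 4) (i : Fin n) {a a' : Ob n}
    {b b' : Ob (m + 1)} {γ γ' : Hom a a'} (δ : Hom b b'),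
    (r hn a a').r γ γ' → (r hnm _ _).r (γ.ins i δ) (γ'.ins i δ)
  ins_right : ∀ {n m : ℕ} (hm : m + 1 ≤ 4) (hnm : n + m ≤ 4) (i : Fin n) {a a' : Ob n}
    {b b' : Ob (m + 1)} (γ : Hom a a') {δ δ' : Hom b b'},
    (r hm b b').r δ δ' → (r hnm _ _).r (γ.ins i δ) (γ.ins i δ')

/-- The morphisms from `a` to `b` in the quotient `PaB^{≤ 4}/∼`.  The objects of the quotient are
those of `PaB^{≤ 4}`. -/
def CompatRel.Q (R : CompatRel) {n : ℕ} (hn : n ≤ 4) (a b : Ob n) : Type := Quotient (R.r hn a b)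

/-- The class `[γ]` of a morphism. -/
def CompatRel.cls (R : CompatRel) {n : ℕ} (hn : n ≤ 4) {a b : Ob n} (γ : Hom a b) : R.Q hn a b :=
  Quotient.mk (R.r hn a b) γ

/-- Composition in the quotient: `[γ] · [η] = [γ · η]`. -/
def CompatRel.comp' (R : CompatRel) {n : ℕ} (hn : n ≤ 4) {a b c : Ob n} :
    R.Q hn b c → R.Q hn a b → R.Q hn a c :=
  Quotient.map₂ Hom.comp (fun _ _ h _ _ h' => R.comp hn h h')

/-- The action of the symmetric group on the quotient: `θ [γ] = [θ γ]`. -/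
def CompatRel.act' (R : CompatRel) {n : ℕ} (hn : n ≤ 4) (θ : Equiv.Perm (Fin n)) {a b : Ob n} :
    R.Q hn a b → R.Q hn (a.act θ) (b.act θ) :=
  Quotient.map (Hom.act θ) (fun _ _ h => (R.act hn θ).1 h)

/-- Elementary insertions in the quotient: `[γ] ∘_i [δ] = [γ ∘_i δ]`. -/
def CompatRel.ins' (R : CompatRel) {n m : ℕ} (hn : n ≤ 4) (hm : m + 1 ≤ 4) (hnm : n + m ≤ 4)
    (i : Fin n) {a a' : Ob n} {b b' : Ob (m + 1)} :
    R.Q hn a a' → R.Q hm b b' → R.Q hnm (a.ins i b) (a'.ins i b') :=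
  Quotient.map₂ (fun γ δ => Hom.ins γ i δ) (fun _ γ' h δ _ h' =>
    (R.r hnm _ _).trans' (R.ins_left hn hnm i δ h) (R.ins_right hm hnm i γ' h'))

/-- A morphism of truncated operads in groupoids `PaB^{≤ 4}/∼_R → PaB^{≤ 4}/∼_S` that is the
identity on objects: a family of functors `PaB(n)/∼_R → PaB(n)/∼_S`, `n ≤ 4`, compatible with the
symmetric groups and with all elementary insertions of total arity at most `4`. -/
@[ext]
structure Mor (R S : CompatRel) where
  map : ∀ {n : ℕ} (hn : n ≤ 4) {a b : Ob n}, R.Q hn a b → S.Q hn a b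
  map_id : ∀ {n : ℕ} (hn : n ≤ 4) (a : Ob n),
    map hn (R.cls hn (Hom.id a)) = S.cls hn (Hom.id a)
  map_comp : ∀ {n : ℕ} (hn : n ≤ 4) {a b c : Ob n} (x : R.Q hn b c) (y : R.Q hn a b),
    map hn (R.comp' hn x y) = S.comp' hn (map hn x) (map hn y)
  map_act : ∀ {n : ℕ} (hn : n ≤ 4) (θ : Equiv.Perm (Fin n)) {a b : Ob n} (x : R.Q hn a b),
    map hn (R.act' hn θ x) = S.act' hn θ (map hn x)
  map_ins : ∀ {n m : ℕ} (hn : n ≤ 4) (hm : m + 1 ≤ 4) (hnm : n + m ≤ 4) (i : Fin n)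
    {a a' : Ob n} {b b' : Ob (m + 1)} (x : R.Q hn a a') (y : R.Q hm b b'),
    map hnm (R.ins' hn hm hnm i x y) = S.ins' hn hm hnm i (map hn x) (map hm y)

/-- The identity morphism of truncated operads. -/
def Mor.id (R : CompatRel) : Mor R R where
  map _ _ _ x := x
  map_id _ _ := rfl
  map_comp _ _ _ _ _ _ := rfl
  map_act _ _ _ _ _ := rfl
  map_ins _ _ _ _ _ _ _ _ _ _ := rfl

/-- The composition `U ∘ T` of morphisms of truncated operads. -/
def Mor.comp {R S W : CompatRel} (U : Mor S W) (T : Mor R S) : Mor R W where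
  map hn _ _ x := U.map hn (T.map hn x)
  map_id hn a := by rw [T.map_id, U.map_id]
  map_comp hn _ _ _ x y := by rw [T.map_comp, U.map_comp]
  map_act hn θ _ _ x := by rw [T.map_act, U.map_act]
  map_ins hn hm hnm i _ _ _ _ x y := by rw [T.map_ins, U.map_ins]

/-- The category whose object `∼` stands for the truncated operad `PaB^{≤ 4}/∼`, and whose
morphisms are the morphisms of truncated operads (identical on objects). -/
instance : CategoryTheory.Category CompatRel where
  Hom := Mor
  id := Mor.id
  comp T U := Mor.comp U T

/-- The equality relation.  The quotient by it is `PaB^{≤ 4}` itself. -/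
def eqRel : CompatRel where
  r _ _ _ := ⊥
  comp := by rintro _ _ _ _ _ _ _ _ _ rfl rfl; rfl
  act := by
    intro n hn θ a b γ γ'
    constructor
    · rintro rfl; rfl
    · intro h
      have h' : γ.act θ = γ'.act θ := h
      exact Hom.ext (congrArg Hom.braid h' :)
  ins_left := by rintro _ _ _ _ _ _ _ _ _ _ _ _ rfl; rfl
  ins_right := by rintro _ _ _ _ _ _ _ _ _ _ _ _ rfl; rfl

/-- The canonical projection `PaB^{≤ 4} → PaB^{≤ 4}/∼`. -/
def proj (R : CompatRel) : Mor eqRel R where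
  map hn := Quotient.map' id (by rintro γ _ rfl; exact (R.r hn _ _).refl' γ)
  map_id _ _ := rfl
  map_comp hn _ _ _ x y := by
    induction x using Quotient.inductionOn
    induction y using Quotient.inductionOn
    rfl
  map_act hn θ _ _ x := by
    induction x using Quotient.inductionOn
    rfl
  map_ins hn hm hnm i _ _ _ _ x y := by
    induction x using Quotient.inductionOn
    induction y using Quotient.inductionOn
    rfl


/-! ### Standard objects and morphisms of `PaB`, cofaces -/

/-- The left parenthesization `(..(• •) •) .. •)` with `m + 1` leaves. -/
def combShape : ℕ → FreeMagma Unit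
  | 0 => .of ()
  | m + 1 => .mul (combShape m) (.of ())

lemma length_combShape (m : ℕ) : (combShape m).length = m + 1 := by
  induction m with
  | zero => rfl
  | succ m ih =>
    change (combShape m).length + 1 = _
    rw [ih]

/-- The object `(..(1 2) 3) .. m+1)`; in particular `comb 1` is `12` and `comb 2` is `(12)3`. -/
def comb (m : ℕ) : Ob (m + 1) := ⟨combShape m, length_combShape m, 1⟩

/-- The object `21`. -/
def ob21 : Ob 2 := ⟨combShape 1, rfl, Equiv.swap 0 1⟩

/-- The object `1(23)`. -/
def ob1_23 : Ob 3 := ⟨.mul (.of ()) (combShape 1), rfl, 1⟩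

/-- The braiding `β : 12 → 21`. -/
def braiding : Hom (comb 1) ob21 := ⟨sig 2 0, by
  rw [rho_sig (by omega)]
  decide⟩

/-- The associator `α : (12)3 → 1(23)`. -/
def assoc : Hom (comb 2) ob1_23 := ⟨1, by simp [comb, ob1_23]⟩

/-- The automorphism `𝔪(h)` of `(..(1 2) 3) .. m+1)` given by a pure braid `h`. -/
def pureHom {m : ℕ} (h : PB (m + 1)) : Hom (comb m) (comb m) := ⟨h, by simp [comb, rho_pure]⟩

/-- The homomorphism `h ↦ 𝔬𝔲(𝔪(h) ∘_p id_{12})`, which doubles the `p`-th strand.  For `h` in `PB 3`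
and `p = 0, 1, 2` it is `φ_{12,3,4}`, `φ_{1,23,4}`, `φ_{1,2,34}`; for `h` in `PB 2` and `p = 0, 1`
it is `φ_{12,3}`, `φ_{1,23}`. -/
def phiDbl {m : ℕ} (p : Fin (m + 1)) : PB (m + 1) →* B (m + 1 + 1) where
  toFun h := ((pureHom h).ins p (Hom.id (comb 1))).braid
  map_one' := by simp [Hom.ins, pureHom, Hom.id, cable_one]
  map_mul' g h := by simp [Hom.ins, pureHom, Hom.id, cable_mul, rho_pure]

/-- The homomorphism `h ↦ 𝔬𝔲(id_{12} ∘_i 𝔪(h))`, which adds a strand on the right (`i = 0`) or on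
the left (`i = 1`).  For `h` in `PB 3` it is `φ_{123}` and `φ_{234}`; for `h` in `PB 2` it is
`φ_{12}` and `φ_{23}`. -/
def phiSide {m : ℕ} (i : Fin 2) : PB (m + 1) →* B (2 + m) where
  toFun h := ((Hom.id (comb 1)).ins i (pureHom h)).braid
  map_one' := by simp [Hom.ins, pureHom, Hom.id, cable_one]
  map_mul' g h := by simp [Hom.ins, pureHom, Hom.id, cable_one]

lemma phiDbl_apply {m : ℕ} (p : Fin (m + 1)) (h : PB (m + 1)) :
    phiDbl p h = cable (h : B (m + 1)) p 1 := by
  simp [phiDbl, Hom.ins, pureHom, Hom.id, comb]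

lemma phiSide_apply {m : ℕ} (i : Fin 2) (h : PB (m + 1)) :
    phiSide i h = place i (h : B (m + 1)) := by
  simp [phiSide, Hom.ins, pureHom, Hom.id, comb, cable_one]

/-- `N_{PB_3}`, as a subgroup of the braid group. -/
def NPB3 (N : Subgroup (B 4)) : Subgroup (B 3) :=
  (N.comap (phiSide 0 : PB 3 →* B 4) ⊓ N.comap (phiDbl 0 : PB 3 →* B 4) ⊓
    N.comap (phiDbl 1 : PB 3 →* B 4) ⊓ N.comap (phiDbl 2 : PB 3 →* B 4) ⊓
    N.comap (phiSide 1 : PB 3 →* B 4)).map (PB 3).subtype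

/-- `N_{PB_2}`, as a subgroup of the braid group. -/
def NPB2 (N : Subgroup (B 4)) : Subgroup (B 2) :=
  ((NPB3 N).comap (phiSide 0 : PB 2 →* B 3) ⊓ (NPB3 N).comap (phiDbl 0 : PB 2 →* B 3) ⊓
    (NPB3 N).comap (phiDbl 1 : PB 2 →* B 3) ⊓
    (NPB3 N).comap (phiSide 1 : PB 2 →* B 3)).map (PB 2).subtype

/-- The subgroups `N_{PB_n}` of `B n`, for `n ≤ 4` (`B 1` is trivial). -/
def NPB (N : Subgroup (B 4)) : (n : ℕ) → Subgroup (B n)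
  | 4 => N
  | 3 => NPB3 N
  | 2 => NPB2 N
  | _ => ⊥

lemma mem_NPB3 {N : Subgroup (B 4)} {h : B 3} : h ∈ NPB3 N ↔ h ∈ PB 3 ∧
    (∀ p : Fin 3, cable h p 1 ∈ N) ∧ ∀ i : Fin 2, (place i h : B 4) ∈ N := by
  simp only [NPB3, Subgroup.mem_map, Subgroup.mem_inf, Subgroup.mem_comap, phiDbl_apply,
    phiSide_apply, Subgroup.coe_subtype, Subtype.exists, Fin.forall_fin_succ]
  constructor
  · rintro ⟨x, hx, h1, rfl⟩
    simp at *
    tauto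
  · rintro ⟨hx, h1⟩
    refine ⟨h, hx, ?_, rfl⟩
    simp at *
    tauto

lemma mem_NPB2 {N : Subgroup (B 4)} {h : B 2} : h ∈ NPB2 N ↔ h ∈ PB 2 ∧
    (∀ p : Fin 2, cable h p 1 ∈ NPB3 N) ∧ ∀ i : Fin 2, (place i h : B 3) ∈ NPB3 N := by
  simp only [NPB2, Subgroup.mem_map, Subgroup.mem_inf, Subgroup.mem_comap, phiDbl_apply,
    phiSide_apply, Subgroup.coe_subtype, Subtype.exists, Fin.forall_fin_two]
  constructor
  · rintro ⟨x, hx, h1, rfl⟩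
    tauto
  · rintro ⟨hx, h1⟩
    exact ⟨h, hx, by tauto, rfl⟩

/-- The poset `NFI_{PB_4}(B_4)`: normal subgroups of finite index of the braid group on four
strands that are contained in the pure braid group. -/
structure NFI where
  N : Subgroup (B 4)
  normal : N.Normal
  finiteIndex : N.FiniteIndex
  le_PB : N ≤ PB 4

lemma PB_le_conj {n : ℕ} {h : B n} (hh : h ∈ PB n) (g : B n) : g * h * g⁻¹ ∈ PB n :=
  (MonoidHom.normal_ker (rho n)).conj_mem h hh g

lemma cable_conj {n m : ℕ} {h : B n} (hh : h ∈ PB n) (g : B n) (p : Fin n) :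
    cable (g * h * g⁻¹) p m =
      cable g ((rho n g)⁻¹ p) m * cable h ((rho n g)⁻¹ p) m * (cable g ((rho n g)⁻¹ p) m)⁻¹ := by
  have h1 : rho n h = 1 := hh
  have h2 := cable_mul g g⁻¹ p m
  rw [mul_inv_cancel, cable_one, map_inv] at h2
  rw [cable_mul, cable_mul, map_inv, h1, eq_inv_of_mul_eq_one_right h2.symm]
  rfl

lemma NPB3_normal {N : Subgroup (B 4)} (hN : N.Normal) : (NPB3 N).Normal := by
  refine ⟨fun h hh g => ?_⟩
  rw [mem_NPB3] at hh ⊢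
  refine ⟨PB_le_conj hh.1 g, fun p => ?_, fun i => ?_⟩
  · rw [cable_conj hh.1]
    exact hN.conj_mem _ (hh.2.1 _) _
  · rw [map_mul, map_mul, map_inv]
    exact hN.conj_mem _ (hh.2.2 _) _

lemma NPB2_normal {N : Subgroup (B 4)} (hN : N.Normal) : (NPB2 N).Normal := by
  refine ⟨fun h hh g => ?_⟩
  rw [mem_NPB2] at hh ⊢
  refine ⟨PB_le_conj hh.1 g, fun p => ?_, fun i => ?_⟩
  · rw [cable_conj hh.1]
    exact (NPB3_normal hN).conj_mem _ (hh.2.1 _) _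
  · rw [map_mul, map_mul, map_inv]
    exact (NPB3_normal hN).conj_mem _ (hh.2.2 _) _

instance NPB_normal (N : NFI) (n : ℕ) : (NPB N.N n).Normal := by
  unfold NPB
  split
  · exact N.normal
  · exact NPB3_normal N.normal
  · exact NPB2_normal N.normal
  · infer_instance

lemma NPB_le_PB (N : NFI) (n : ℕ) : NPB N.N n ≤ PB n := by
  unfold NPB
  split
  · exact N.le_PB
  · exact fun h hh => (mem_NPB3.1 hh).1
  · exact fun h hh => (mem_NPB2.1 hh).1
  · exact bot_le

lemma dbl_mem_NPB (N : NFI) {n : ℕ} (hn : n + 1 ≤ 4) {h : B n} (hh : h ∈ NPB N.N n) (p : Fin n) :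
    dbl h p ∈ NPB N.N (n + 1) := by
  have hq : n = 0 ∨ n = 1 ∨ n = 2 ∨ n = 3 := by omega
  rcases hq with rfl | rfl | rfl | rfl
  · exact p.elim0
  · obtain rfl : h = 1 := hh
    rw [dbl_one]
    exact one_mem _
  · exact (mem_NPB2.1 hh).2.1 p
  · exact (mem_NPB3.1 hh).2.1 p

lemma cable_mem_NPB (N : NFI) {n m : ℕ} (hnm : n + m ≤ 4) {h : B n} (hh : h ∈ NPB N.N n)
    (p : Fin n) : cable h p m ∈ NPB N.N (n + m) := by
  induction m with
  | zero => exact hh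
  | succ m ih => exact dbl_mem_NPB N hnm (ih (by omega)) _

lemma place_self {m : ℕ} (p : Fin 1) (e : m + 1 = 1 + m) (h : B (m + 1)) :
    (place p h : B (1 + m)) = cast (congrArg B e) h := by
  have hp : (p : ℕ) = 0 := by omega
  have key : ∀ k (e : m + 1 = k) (f : B (m + 1) →* B k),
      (∀ i, i + 1 < m + 1 → f (sig (m + 1) i) = sig k i) → ∀ h, f h = cast (congrArg B e) h := by
    rintro k rfl f hf h
    induction h using B_induction with
    | h1 => simp
    | hs i hi => exact hf i hi
    | hm g h hg hh => rw [map_mul, hg, hh]; rfl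
    | hi g hg => rw [map_inv, hg]; rfl
  refine key _ e (place p) (fun i hi => ?_) h
  rw [place_sig p hi, hp, zero_add]

lemma place_place (p : Fin 3) (i j : Fin 2) (hp : (p : ℕ) = j + i) (h : B 2) :
    (place p h : B 4) = (place j (place i h : B 3) : B 4) := by
  induction h using B_induction with
  | h1 => simp
  | hs k hk =>
    have h1 : (place i (sig 2 k) : B 3) = sig 3 (i + k) := place_sig (n := 2) (m := 1) i hk
    have h2 : (place j (sig 3 (i + k)) : B 4) = sig 4 (j + (i + k)) :=
      place_sig (n := 2) (m := 2) j (by omega)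
    have h3 : (place p (sig 2 k) : B 4) = sig 4 (p + k) := place_sig (n := 3) (m := 1) p hk
    rw [h1, h2, h3, hp, add_assoc]
  | hm g h hg hh => rw [map_mul, map_mul, map_mul, hg, hh]
  | hi g hg => rw [map_inv, map_inv, map_inv, hg]

lemma place_mem_NPB (N : NFI) {n m : ℕ} (hnm : n + m ≤ 4) {h : B (m + 1)}
    (hh : h ∈ NPB N.N (m + 1)) (p : Fin n) : (place p h : B (n + m)) ∈ NPB N.N (n + m) := by
  have hp := p.2
  have hm : m = 0 ∨ m = 1 ∨ m = 2 ∨ m = 3 := by omega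
  have hn : n = 0 ∨ n = 1 ∨ (n = 2 ∧ m ≤ 2) ∨ (n = 3 ∧ m ≤ 1) ∨ (n = 4 ∧ m = 0) := by omega
  rcases hn with rfl | rfl | ⟨rfl, hn⟩ | ⟨rfl, hn⟩ | ⟨rfl, hn⟩
  · exact p.elim0
  · rw [place_self p (by omega)]
    rcases hm with rfl | rfl | rfl | rfl <;> exact hh
  all_goals
    rcases hm with rfl | rfl | rfl | rfl
    · obtain rfl : h = 1 := hh
      rw [map_one]
      exact one_mem _
  · exact (mem_NPB2.1 hh).2.2 p
  · exact (mem_NPB3.1 hh).2.2 p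
  · omega
  · have hi := (mem_NPB2.1 hh).2.2
    have hp : (p : ℕ) = 0 ∨ (p : ℕ) = 1 ∨ (p : ℕ) = 2 := by omega
    change (place p h : B 4) ∈ N.N
    rcases hp with hp | hp | hp
    · rw [place_place p 0 0 (by simp [hp])]
      exact (mem_NPB3.1 (hi 0)).2.2 0
    · rw [place_place p 1 0 (by simp [hp])]
      exact (mem_NPB3.1 (hi 1)).2.2 0
    · rw [place_place p 1 1 (by simp [hp])]
      exact (mem_NPB3.1 (hi 1)).2.2 1
  all_goals omega

/-- The compatible equivalence relation `∼_N` attached to `N`. -/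
def rel (N : NFI) : CompatRel where
  r {n} _ a b :=
    { r := fun γ γ' => γ.braid⁻¹ * γ'.braid ∈ NPB N.N n
      iseqv := ⟨fun γ => by simp, fun {γ γ'} h => by simpa using inv_mem h,
        fun {γ γ' γ''} h h' => by simpa [mul_assoc] using mul_mem h h'⟩ }
  comp {n} hn {a b c γ γ' η η'} h h' := by
    have := mul_mem ((NPB_normal N n).conj_mem _ h η.braid⁻¹) h'
    simpa [Hom.comp, mul_assoc] using this
  act hn θ _ _ γ γ' := Iff.rfl
  ins_left {n m} hn hnm i {a a' b b' γ γ'} δ h := by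
    have hr : rho n γ'.braid = rho n γ.braid := by rw [γ.rho_braid, γ'.rho_braid]
    have h1 := cable_mem_NPB N hnm h (a.perm⁻¹ i)
    have h2 := (NPB_normal N (n + m)).conj_mem _ h1 (place (a.perm⁻¹ i) δ.braid)⁻¹
    have h3 : cable γ'.braid (a.perm⁻¹ i) m = cable γ.braid (a.perm⁻¹ i) m *
        cable (γ.braid⁻¹ * γ'.braid) (a.perm⁻¹ i) m := by
      have := cable_mul γ.braid (γ.braid⁻¹ * γ'.braid) (a.perm⁻¹ i) m
      rw [mul_inv_cancel_left, map_mul, map_inv, hr, inv_mul_cancel] at this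
      exact this
    change (cable γ.braid (a.perm⁻¹ i) m * place (a.perm⁻¹ i) δ.braid)⁻¹ *
      (cable γ'.braid (a.perm⁻¹ i) m * place (a.perm⁻¹ i) δ.braid) ∈ NPB N.N (n + m)
    rw [h3]
    simpa only [mul_assoc, mul_inv_rev, inv_inv, inv_mul_cancel_left] using h2
  ins_right {n m} hm hnm i {a a' b b'} γ {δ δ'} h := by
    have := place_mem_NPB N hnm h (a.perm⁻¹ i)
    simpa [Hom.ins, mul_assoc] using this


/-! ### `GT`-pairs, `GT`-shadows and the groupoid `GTSh` -/

/-- The set of objects of `GTSh`. -/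
abbrev GTSh : Type := NFI

/-- The groupoid `GTSh`: its objects are the elements of `NFI_{PB_4}(B_4)`, the morphisms from `N₁`
to `N₂` are the isomorphisms of truncated operads `PaB^{≤ 4}/∼_{N₁} ≅ PaB^{≤ 4}/∼_{N₂}` (identical
on objects), and `T₁ ≫ T₂` is the composition `T₂ ∘ T₁` of isomorphisms. -/
instance : CategoryTheory.Groupoid NFI where
  Hom N₁ N₂ := rel N₁ ≅ rel N₂
  id N := CategoryTheory.Iso.refl (rel N)
  comp T₁ T₂ := T₁ ≪≫ T₂
  id_comp T := CategoryTheory.Iso.refl_trans T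
  comp_id T := CategoryTheory.Iso.trans_refl T
  assoc T₁ T₂ T₃ := CategoryTheory.Iso.trans_assoc T₁ T₂ T₃
  inv T := T.symm
  inv_comp T := CategoryTheory.Iso.symm_self_id T
  comp_inv T := CategoryTheory.Iso.self_symm_id T

/-- The morphism of truncated operads `PaB^{≤ 4} → PaB^{≤ 4}/∼_{N₁} ≅ PaB^{≤ 4}/∼_{N₂}` underlying
a morphism of `GTSh`. -/
def GTSh.toMor {N₁ N₂ : GTSh} (T : N₁ ⟶ N₂) : Mor eqRel (rel N₂) :=
  Mor.comp (CategoryTheory.Iso.hom T) (proj (rel N₁))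

/-- The element `σ_i ^ 2` of the pure braid group: `sq 2 0` and `sq 3 0` are `x_{12}`, and `sq 3 1`
is `x_{23}`. -/
def sq (n i : ℕ) : PB n := ⟨sig n i ^ 2, by
  change rho n (sig n i ^ 2) = 1
  by_cases h : i + 1 < n
  · rw [map_pow, rho_sig h, pow_two, mul_eq_one_iff_eq_inv, tr_inv]
  · have : ¬ i < n - 1 := by omega
    simp [sig, this]⟩

/-- The generator `x_{13} = σ_2 σ_1² σ_2⁻¹` of the pure braid group on three strands. -/
def x13 : B 3 := sig 3 1 * sig 3 0 ^ 2 * (sig 3 1)⁻¹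

/-- The two hexagon relations in `B_3/N_{PB_3}` and the pentagon relation in `B_4/N`, which say
that `(m, f)` represents a `GT`-pair, an element of `GT_pr(N)`. -/
structure IsGTPair (N : NFI) (m : ℤ) (f : PB 3) : Prop where
  hexagon₁ : ((sig 3 0 * (sq 3 0) ^ m * (f : B 3)⁻¹ * sig 3 1 * (sq 3 1) ^ m * f : B 3) :
      B 3 ⧸ NPB N.N 3) =
    ((f : B 3)⁻¹ * sig 3 0 * sig 3 1 * (x13 * sq 3 1) ^ m : B 3)
  hexagon₂ : (((f : B 3)⁻¹ * sig 3 1 * (sq 3 1) ^ m * f * sig 3 0 * (sq 3 0) ^ m : B 3) :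
      B 3 ⧸ NPB N.N 3) =
    (sig 3 1 * sig 3 0 * (sq 3 0 * x13) ^ m * f : B 3)
  pentagon : ((phiSide 1 f * phiDbl 1 f * phiSide 0 f : B 4) : B 4 ⧸ N.N) =
    (phiDbl 2 f * phiDbl 0 f : B 4)

/-- `T` is the morphism of truncated operads `T_{m,f}`, the one with
`T(α) = [α · 𝔪(f)]` and `T(β) = [β · 𝔪(x_{12}^m)]`. -/
def IsT {N : NFI} (T : Mor eqRel (rel N)) (m : ℤ) (f : PB 3) : Prop :=
  T.map (by norm_num) (eqRel.cls (by norm_num) assoc) =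
      (rel N).cls (by norm_num) (assoc.comp (pureHom f)) ∧
    T.map (by norm_num) (eqRel.cls (by norm_num) braiding) =
      (rel N).cls (by norm_num) (braiding.comp (pureHom (sq 2 0 ^ m)))

/-- The coset of the pure braid underlying an automorphism in `PaB(n)/∼_N`. -/
def ouClass {N : NFI} {n : ℕ} (hn : n ≤ 4) {a : Ob n} :
    (rel N).Q hn a a → PB n ⧸ (NPB N.N n).subgroupOf (PB n) :=
  Quotient.lift
    (fun γ => (QuotientGroup.mk ⟨γ.braid, by
      change rho n γ.braid = 1
      rw [γ.rho_braid, inv_mul_cancel]⟩ : PB n ⧸ (NPB N.N n).subgroupOf (PB n)))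
    (fun _ _ h => QuotientGroup.eq.2 h)

/-- The map `T^{PB_n} = 𝔬𝔲 ∘ T ∘ 𝔪 : PB_n → PB_n/N_{PB_n}`, where `n = k + 1`. -/
def TPB {N : NFI} (T : Mor eqRel (rel N)) {k : ℕ} (hk : k + 1 ≤ 4) (h : PB (k + 1)) :
    PB (k + 1) ⧸ (NPB N.N (k + 1)).subgroupOf (PB (k + 1)) :=
  ouClass hk (T.map hk (eqRel.cls hk (pureHom h)))

/-- `T^{PB_2}`. -/
def TPB2 {N : NFI} (T : Mor eqRel (rel N)) : PB 2 → PB 2 ⧸ (NPB N.N 2).subgroupOf (PB 2) :=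
  TPB T (k := 1) (by norm_num)

/-- `T^{PB_3}`. -/
def TPB3 {N : NFI} (T : Mor eqRel (rel N)) : PB 3 → PB 3 ⧸ (NPB N.N 3).subgroupOf (PB 3) :=
  TPB T (k := 2) (by norm_num)

/-- `T^{PB_4}`. -/
def TPB4 {N : NFI} (T : Mor eqRel (rel N)) : PB 4 → PB 4 ⧸ (NPB N.N 4).subgroupOf (PB 4) :=
  TPB T (k := 3) (by norm_num)

/-- `(m, f)` represents a `GT`-shadow, an element of `GT(N)`: it is a `GT`-pair, and the maps
`T_{m,f}^{PB_n}` are onto for `n = 2, 3, 4`. -/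
def IsGTShadow (N : NFI) (m : ℤ) (f : PB 3) : Prop :=
  IsGTPair N m f ∧ ∃ T : Mor eqRel (rel N), IsT T m f ∧
    Function.Surjective (TPB2 T) ∧
    Function.Surjective (TPB3 T) ∧
    Function.Surjective (TPB4 T)

/-- The morphism `T` of `GTSh` is represented by the pair `(m, f)`, that is `T = [(m, f)]`. -/
def GTSh.Represents {N₁ N₂ : GTSh} (T : N₁ ⟶ N₂) (m : ℤ) (f : PB 3) : Prop :=
  IsT (GTSh.toMor T) m f

/-- The homomorphism `w ↦ w(x_{12}, x_{23})` from the free group `F_2 = ⟨x, y⟩` to `PB_3`. -/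
def evalXY : FreeGroup (Fin 2) →* PB 3 := FreeGroup.lift ![sq 3 0, sq 3 1]

end GTS

open GTS CategoryTheory

namespace GTS

/-! A morphism of truncated operads respects composition, relabelling and insertion, so its value on
any morphism assembled from α and β is assembled in the same way from T(α) and T(β). All parts of
the proposition come from this.

The composition formula (`represents_comp`): T₂ sends α·𝔪(f₁) to T₂(α)·T₂(𝔪(f₁)), whose braid is f₂
times a representative of T₂^{PB₃}(f₁). Following β by its relabelling gives the full twist x₁₂, so
T₂ sends x₁₂ to x₁₂^{2m₂+1} (`IsT.sq_two`). Hence β·𝔪(x₁₂^{m₁}) goes to β with the twist exponent m₂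
+ (2m₂+1)m₁.

That (m,f) is a GT-shadow is not computed from the formula; it holds for any pair representing a
morphism of `GTSh` (`IsT.isGTShadow`). The two sides of each hexagon, and of the pentagon, are the
images of a single morphism of PaB written in two ways as a composite, hence they agree modulo N
(`SendsTo.eq_coset`). Surjectivity and the kernel follow from invertibility: the inverse isomorphism
supplies preimages and shows that nothing outside the kernel of the projection is killed.

For practical shadows, T^{PB₃} is multiplicative with known values on x₁₂ and x₂₃, so on words it is
a substitution (`IsT.evalXY`).

The bookkeeping runs through `SendsTo`, a relation between bare braids with source and target as
parameters. Equal objects can then be exchanged without transporting morphisms, and braid identities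
can be used for rewriting directly. -/

/-! ### Calculus of values of a morphism of operads on braids -/

lemma cls_eq_of_braid {R : CompatRel} {n : ℕ} (hn : n ≤ 4) {a b : Ob n} {γ δ : Hom a b}
    (h : γ.braid = δ.braid) : R.cls hn γ = R.cls hn δ :=
  congrArg _ (Hom.ext h)

/-- The inverse of a morphism. -/
def Hom.inv {n : ℕ} {a b : Ob n} (γ : Hom a b) : Hom b a :=
  ⟨γ.braid⁻¹, by rw [map_inv, γ.rho_braid]; group⟩

lemma Ob.ext' {n : ℕ} {a b : Ob n} (hs : a.shape = b.shape) (hp : a.perm = b.perm) : a = b := by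
  cases a; cases b; cases hs; cases hp; rfl

/-- The morphism `T` of truncated operads sends the class of the morphism `a → b` with braid `g`
to the class of the morphism with braid `g'`. -/
def SendsTo {R S : CompatRel} (T : Mor R S) {n : ℕ} (a b : Ob n) (g g' : B n) : Prop :=
  ∃ (hn : n ≤ 4) (γ δ : Hom a b), γ.braid = g ∧ δ.braid = g' ∧
    T.map hn (R.cls hn γ) = S.cls hn δ

namespace SendsTo

variable {R S : CompatRel} {T : Mor R S} {n : ℕ} {a b c : Ob n} {g g' h h' : B n}

lemma one (hn : n ≤ 4) (a : Ob n) : SendsTo T a a 1 1 :=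
  ⟨hn, Hom.id a, Hom.id a, rfl, rfl, T.map_id hn a⟩

lemma mul (hg : SendsTo T b c g g') (hh : SendsTo T a b h h') :
    SendsTo T a c (g * h) (g' * h') := by
  obtain ⟨hn, γ, δ, rfl, rfl, e⟩ := hg
  obtain ⟨_, η, ε, rfl, rfl, e'⟩ := hh
  refine ⟨hn, γ.comp η, δ.comp ε, rfl, rfl, ?_⟩
  have := T.map_comp hn (R.cls hn γ) (R.cls hn η)
  rw [e, e'] at this
  exact this

/-- Preservation of inverses is not part of `Mor`; it is forced by functoriality, since T(γ)·T(γ⁻¹)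
is the class of an identity. -/
lemma inv (hg : SendsTo T a b g g') : SendsTo T b a g⁻¹ g'⁻¹ := by
  obtain ⟨hn, γ, δ, rfl, rfl, e⟩ := hg
  refine ⟨hn, γ.inv, δ.inv, rfl, rfl, ?_⟩
  obtain ⟨ε, hε⟩ := Quotient.exists_rep (T.map hn (R.cls hn γ.inv))
  have h1 : R.comp' hn (R.cls hn γ) (R.cls hn γ.inv) = R.cls hn (Hom.id b) :=
    cls_eq_of_braid hn (mul_inv_cancel γ.braid)
  have h2 := T.map_comp hn (R.cls hn γ) (R.cls hn γ.inv)
  rw [h1, T.map_id, e, ← hε] at h2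
  rw [← hε]
  have h3 : (S.r hn b b).r (Hom.id b) (δ.comp ε) := Quotient.exact h2
  -- Multiplying id ∼ δ·ε by δ⁻¹ on the left yields δ⁻¹ ∼ ε, where ε represents T(γ⁻¹).
  have h4 := S.comp hn ((S.r hn b a).refl' δ.inv) h3
  refine (Quotient.sound ?_ : S.cls hn ε = S.cls hn δ.inv)
  have e1 : δ.inv.comp (Hom.id b) = δ.inv := Hom.ext (mul_one _)
  have e2 : δ.inv.comp (δ.comp ε) = ε := Hom.ext (inv_mul_cancel_left _ _)
  rw [e1, e2] at h4
  exact (S.r hn b a).symm' h4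

lemma pow (hg : SendsTo T a a g g') (k : ℕ) : SendsTo T a a (g ^ k) (g' ^ k) := by
  induction k with
  | zero => simpa using one hg.choose a
  | succ k ih => simpa only [pow_succ] using ih.mul hg

lemma zpow (hg : SendsTo T a a g g') (k : ℤ) : SendsTo T a a (g ^ k) (g' ^ k) := by
  cases k with
  | ofNat k => simpa using hg.pow k
  | negSucc k => simpa only [zpow_negSucc] using (hg.pow (k + 1)).inv

lemma act (θ : Equiv.Perm (Fin n)) (hg : SendsTo T a b g g') :
    SendsTo T (a.act θ) (b.act θ) g g' := by
  obtain ⟨hn, γ, δ, rfl, rfl, e⟩ := hg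
  refine ⟨hn, γ.act θ, δ.act θ, rfl, rfl, ?_⟩
  have := T.map_act hn θ (R.cls hn γ)
  rw [e] at this
  exact this

lemma ins {m : ℕ} {d d' : Ob (m + 1)} {k k' : B (m + 1)} (hnm : n + m ≤ 4) (i : Fin n)
    (hg : SendsTo T a b g g') (hk : SendsTo T d d' k k') :
    SendsTo T (a.ins i d) (b.ins i d') (cable g (a.perm⁻¹ i) m * place (a.perm⁻¹ i) k)
      (cable g' (a.perm⁻¹ i) m * place (a.perm⁻¹ i) k') := by
  obtain ⟨hn, γ, δ, rfl, rfl, e⟩ := hg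
  obtain ⟨hm, η, ε, rfl, rfl, e'⟩ := hk
  refine ⟨hnm, γ.ins i η, δ.ins i ε, rfl, rfl, ?_⟩
  have := T.map_ins hn hm hnm i (R.cls hn γ) (R.cls hm η)
  rw [e, e'] at this
  exact this

lemma ins_id {m : ℕ} (d : Ob (m + 1)) (hm : m + 1 ≤ 4) (hnm : n + m ≤ 4) (i : Fin n)
    (hg : SendsTo T a b g g') :
    SendsTo T (a.ins i d) (b.ins i d) (cable g (a.perm⁻¹ i) m) (cable g' (a.perm⁻¹ i) m) := by
  simpa using hg.ins hnm i (one hm d)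

lemma id_ins {m : ℕ} {d d' : Ob (m + 1)} {k k' : B (m + 1)} (hn : n ≤ 4) (hnm : n + m ≤ 4)
    (a : Ob n) (i : Fin n) (hk : SendsTo T d d' k k') :
    SendsTo T (a.ins i d) (a.ins i d') (place (a.perm⁻¹ i) k) (place (a.perm⁻¹ i) k') := by
  simpa [cable_one] using (one hn a).ins hnm i hk

/-- Insertions produce objects that have to be proved equal to the standard ones. The braids do not
depend on the objects, so the exchange leaves them untouched. -/
lemma congr_ob {a' b' : Ob n} (hg : SendsTo T a b g g') (ha : a = a') (hb : b = b') :
    SendsTo T a' b' g g' := ha ▸ hb ▸ hg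

/-- A morphism of PaB is determined by its source, target and braid, so two computations that start
from the same braid evaluate T on the same class. The hexagons and the pentagon are instances. -/
lemma eq_coset {N : NFI} {T : Mor R (rel N)} (hg : SendsTo T a b g g') (hg' : SendsTo T a b g h) :
    (g' : B n ⧸ NPB N.N n) = h := by
  obtain ⟨hn, γ, δ, rfl, rfl, e⟩ := hg
  obtain ⟨_, γ', ε, e1, rfl, e'⟩ := hg'
  obtain rfl : γ' = γ := Hom.ext e1
  exact QuotientGroup.eq.2 (Quotient.exact (e.symm.trans e'))

end SendsTo

/-! ### Images of α, β and of the squares of the generators -/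

lemma sq_zpow_two_mul_add_one {G : Type*} [Group G] (s : G) (m : ℤ) :
    (s ^ 2) ^ (2 * m + 1) = s * (s ^ 2) ^ m * (s * (s ^ 2) ^ m) := by
  have h : s * (s ^ 2) ^ m = s ^ (1 + 2 * m) := by
    rw [zpow_add, zpow_one, zpow_mul, zpow_ofNat]
  rw [h, ← zpow_add, ← zpow_natCast s 2, ← zpow_mul]
  congr 1
  push_cast
  ring

section Represented

variable {N : NFI} {T : Mor eqRel (rel N)} {m : ℤ} {f : PB 3}

lemma IsT.assoc (hT : IsT T m f) : SendsTo T (comb 2) ob1_23 1 f :=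
  ⟨by norm_num, _, _, rfl, one_mul _, hT.1⟩

lemma IsT.braiding (hT : IsT T m f) :
    SendsTo T (comb 1) ob21 (sig 2 0) (sig 2 0 * (sig 2 0 ^ 2) ^ m) :=
  ⟨by norm_num, _, _, rfl, by simp [Hom.comp, GTS.braiding, pureHom, sq], hT.2⟩

lemma IsT.of_sendsTo (h1 : SendsTo T (comb 2) ob1_23 1 f)
    (h2 : SendsTo T (comb 1) ob21 (sig 2 0) (sig 2 0 * (sig 2 0 ^ 2) ^ m)) : IsT T m f := by
  obtain ⟨_, γ, δ, e1, e2, e3⟩ := h1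
  obtain ⟨_, γ', δ', e1', e2', e3'⟩ := h2
  obtain rfl : γ = GTS.assoc := Hom.ext e1
  obtain rfl : γ' = GTS.braiding := Hom.ext e1'
  refine ⟨e3.trans (cls_eq_of_braid _ ?_), e3'.trans (cls_eq_of_braid _ ?_)⟩
  · rw [e2]; exact (one_mul _).symm
  · rw [e2']; simp [Hom.comp, GTS.braiding, pureHom, sq]

lemma IsT.sq_two (hT : IsT T m f) :
    SendsTo T (comb 1) (comb 1) (sig 2 0 ^ 2) ((sig 2 0 ^ 2) ^ (2 * m + 1)) := by
  -- Relabelling by the swap turns β into a morphism 21 → 12, so that it can be composed with β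
  -- itself.
  have h := ((hT.braiding.act (Equiv.swap 0 1)).congr_ob (a' := ob21) (b' := comb 1)
    (Ob.ext' rfl (by decide)) (Ob.ext' rfl (by decide))).mul hT.braiding
  convert h using 1
  · exact pow_two _
  · exact sq_zpow_two_mul_add_one (sig 2 0) m

lemma IsT.sq_three_zero (hT : IsT T m f) :
    SendsTo T (comb 2) (comb 2) (sig 3 0 ^ 2) ((sig 3 0 ^ 2) ^ (2 * m + 1)) := by
  have h := (hT.sq_two.id_ins (by norm_num) (by norm_num) (comb 1) 0).congr_ob
    (a' := comb 2) (b' := comb 2)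
    (Ob.ext' (by decide) (by decide)) (Ob.ext' (by decide) (by decide))
  have e : (place ((comb 1).perm⁻¹ 0) (sig 2 0) : B 3) = sig 3 0 :=
    place_sig (n := 2) (m := 1) _ (by norm_num)
  rw [map_zpow, map_pow, e] at h
  exact h

/-- Inserting the full twist into the second leaf of 12 gives an automorphism of 1(23) rather than
of (12)3. Conjugation by α brings it back, and this is where f enters. -/
lemma IsT.sq_three_one (hT : IsT T m f) :
    SendsTo T (comb 2) (comb 2) (sig 3 1 ^ 2) (f⁻¹ * (sig 3 1 ^ 2) ^ (2 * m + 1) * f) := by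
  have h := (hT.sq_two.id_ins (by norm_num) (by norm_num) (comb 1) 1).congr_ob
    (a' := ob1_23) (b' := ob1_23)
    (Ob.ext' (by decide) (by decide)) (Ob.ext' (by decide) (by decide))
  have e : (place ((comb 1).perm⁻¹ 1) (sig 2 0) : B 3) = sig 3 1 :=
    place_sig (n := 2) (m := 1) _ (by norm_num)
  rw [map_zpow, map_pow, e] at h
  simpa using (hT.assoc.inv.mul h).mul hT.assoc

end Represented

/-! ### Hexagon and pentagon relations -/

section Relations

variable {N : NFI} {T : Mor eqRel (rel N)} {m : ℤ} {f : PB 3}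

lemma cable_zero_sig_two : cable (sig 2 0) 0 1 = sig 3 0 * sig 3 1 := by
  change dbl (sig 2 0) _ = _
  rw [dbl_sig (by norm_num)]
  -- `dblGen` is indexed by the position where the doubled strand ends: the strand starting at 0
  -- ends at 1.
  exact dblGen_succ 2 0

lemma cable_one_sig_two : cable (sig 2 0) 1 1 = sig 3 1 * sig 3 0 := by
  change dbl (sig 2 0) _ = _
  rw [dbl_sig (by norm_num)]
  exact dblGen_self 2 0

/-- Cabling is not multiplicative in general: the left factor has to be cabled at the position to
which the right factor moves the strand. Pure braids move nothing, so on them cabling is the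
homomorphism `phiDbl` and commutes with integer powers. -/
lemma cable_mul_zpow {n : ℕ} (g : B (n + 1)) (h : PB (n + 1)) (p : Fin (n + 1)) (j : ℤ) :
    cable (g * (h : B (n + 1)) ^ j) p 1 = cable g p 1 * cable (h : B (n + 1)) p 1 ^ j := by
  rw [cable_mul, ← phiDbl_apply, ← map_zpow, phiDbl_apply, ← Subgroup.coe_zpow, rho_pure]
  rfl

lemma rho_sig_two_zero : rho 2 (sig 2 0) 0 = 1 ∧ rho 2 (sig 2 0) 1 = 0 := by
  rw [rho_sig (by norm_num)]
  decide

/-- After the first crossing the doubled strand sits at position 1, so the second crossing is cabled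
there. The product σ₂σ₁·σ₁σ₂ is x₁₃x₂₃ by cancellation alone; the companion `cable_one_sq` needs the
braid relation. -/
lemma cable_zero_sq : cable (sig 2 0 ^ 2) 0 1 = x13 * sig 3 1 ^ 2 := by
  rw [pow_two, cable_mul, rho_sig_two_zero.1, cable_zero_sig_two, cable_one_sig_two]
  change sig 3 1 * sig 3 0 * (sig 3 0 * sig 3 1) = sig 3 1 * sig 3 0 ^ 2 * (sig 3 1)⁻¹ * sig 3 1 ^ 2
  simp [pow_two, mul_assoc]

lemma mul_mul_mul_eq_of_braid {G : Type*} [Group G] {x y : G} (h : x * y * x = y * x * y) :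
    x * y * (y * x) = x ^ 2 * (y * x ^ 2 * y⁻¹) := by
  rw [← mul_assoc (x ^ 2), eq_mul_inv_iff_mul_eq]
  calc x * y * (y * x) * y = x * y * (y * x * y) := by simp only [mul_assoc]
    _ = x * y * (x * y * x) := by rw [h]
    _ = x * (y * x * y) * x := by simp only [mul_assoc]
    _ = x * (x * y * x) * x := by rw [h]
    _ = x ^ 2 * (y * x ^ 2) := by simp only [pow_two, mul_assoc]

lemma cable_one_sq : cable (sig 2 0 ^ 2) 1 1 = sig 3 0 ^ 2 * x13 := by
  rw [pow_two, cable_mul, rho_sig_two_zero.2, cable_zero_sig_two, cable_one_sig_two]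
  exact mul_mul_mul_eq_of_braid (sig_braid 3 (i := 0) (by norm_num))

/-- This is the side of the first hexagon where the pair (12) crosses 3 in one move. -/
lemma IsT.cable_braiding_zero (hT : IsT T m f) :
    SendsTo T ((comb 1).ins 0 (comb 1)) (ob21.ins 0 (comb 1)) (sig 3 0 * sig 3 1)
      (sig 3 0 * sig 3 1 * (x13 * sig 3 1 ^ 2) ^ m) := by
  have h := hT.braiding.ins_id (comb 1) (by norm_num) (by norm_num) 0
  have e := cable_mul_zpow (sig 2 0) (sq 2 0) ((comb 1).perm⁻¹ 0) m
  -- The labels of `comb 1` are in their natural order, so label and position agree by definition.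
  change cable (sig 2 0 * (sig 2 0 ^ 2) ^ m) 0 1 =
    cable (sig 2 0) 0 1 * cable (sig 2 0 ^ 2) 0 1 ^ m at e
  change SendsTo T _ _ (cable (sig 2 0) 0 1) (cable (sig 2 0 * (sig 2 0 ^ 2) ^ m) 0 1) at h
  rwa [e, cable_zero_sq, cable_zero_sig_two] at h

lemma IsT.cable_braiding_one (hT : IsT T m f) :
    SendsTo T ((comb 1).ins 1 (comb 1)) (ob21.ins 1 (comb 1)) (sig 3 1 * sig 3 0)
      (sig 3 1 * sig 3 0 * (sig 3 0 ^ 2 * x13) ^ m) := by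
  have h := hT.braiding.ins_id (comb 1) (by norm_num) (by norm_num) 1
  have e := cable_mul_zpow (sig 2 0) (sq 2 0) ((comb 1).perm⁻¹ 1) m
  change cable (sig 2 0 * (sig 2 0 ^ 2) ^ m) 1 1 =
    cable (sig 2 0) 1 1 * cable (sig 2 0 ^ 2) 1 1 ^ m at e
  change SendsTo T _ _ (cable (sig 2 0) 1 1) (cable (sig 2 0 * (sig 2 0 ^ 2) ^ m) 1 1) at h
  rwa [e, cable_one_sq, cable_one_sig_two] at h

lemma IsT.place_braiding_zero (hT : IsT T m f) :
    SendsTo T ((comb 1).ins 0 (comb 1)) ((comb 1).ins 0 ob21) (sig 3 0)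
      (sig 3 0 * (sig 3 0 ^ 2) ^ m) := by
  have h := hT.braiding.id_ins (by norm_num) (by norm_num) (comb 1) 0
  have e : (place ((comb 1).perm⁻¹ 0) (sig 2 0) : B 3) = sig 3 0 :=
    place_sig (n := 2) (m := 1) _ (by norm_num)
  rw [map_mul, map_zpow, map_pow, e] at h
  exact h

lemma IsT.place_braiding_one (hT : IsT T m f) :
    SendsTo T ((comb 1).ins 1 (comb 1)) ((comb 1).ins 1 ob21) (sig 3 1)
      (sig 3 1 * (sig 3 1 ^ 2) ^ m) := by
  have h := hT.braiding.id_ins (by norm_num) (by norm_num) (comb 1) 1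
  have e : (place ((comb 1).perm⁻¹ 1) (sig 2 0) : B 3) = sig 3 1 :=
    place_sig (n := 2) (m := 1) _ (by norm_num)
  rw [map_mul, map_zpow, map_pow, e] at h
  exact h

lemma IsT.hexagon_one (hT : IsT T m f) :
    ((sig 3 0 * (sig 3 0 ^ 2) ^ m * (f : B 3)⁻¹ * (sig 3 1 * (sig 3 1 ^ 2) ^ m) * f : B 3) :
      B 3 ⧸ NPB N.N 3) = ((f : B 3)⁻¹ * (sig 3 0 * sig 3 1 * (x13 * sig 3 1 ^ 2) ^ m) : B 3) := by
  -- the two paths from `(12)3` to `(31)2`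
  let o132 : Equiv.Perm (Fin 3) := Equiv.swap 1 2
  let o312 : Equiv.Perm (Fin 3) := finRotate 3 * finRotate 3
  have e1 : (comb 1).ins 1 (comb 1) = ob1_23 := Ob.ext' (by decide) (by decide)
  have e2 : (comb 1).ins 1 ob21 = ob1_23.act o132 := Ob.ext' (by decide) (by decide)
  have e3 : ((comb 1).ins 0 (comb 1)).act o132 = (comb 2).act o132 :=
    Ob.ext' (by decide) (by decide)
  have e4 : ((comb 1).ins 0 ob21).act o132 = (comb 2).act o312 := Ob.ext' (by decide) (by decide)
  have e5 : (comb 1).ins 0 (comb 1) = comb 2 := Ob.ext' (by decide) (by decide)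
  have e6 : ob21.ins 0 (comb 1) = ob1_23.act o312 := Ob.ext' (by decide) (by decide)
  have p1 := (((hT.place_braiding_zero.act o132).congr_ob e3 e4).mul
    (hT.assoc.act o132).inv).mul ((hT.place_braiding_one.congr_ob e1 e2).mul hT.assoc)
  have p2 := (hT.assoc.act o312).inv.mul (hT.cable_braiding_zero.congr_ob e5 e6)
  -- Associators have trivial braid, so both source braids reduce to σ₁σ₂, as `eq_coset` requires.
  simp only [inv_one, mul_one, one_mul] at p1 p2
  simpa only [mul_assoc] using p1.eq_coset p2

lemma IsT.hexagon_two (hT : IsT T m f) :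
    (((f : B 3)⁻¹ * (sig 3 1 * (sig 3 1 ^ 2) ^ m) * f * (sig 3 0 * (sig 3 0 ^ 2) ^ m) : B 3) :
      B 3 ⧸ NPB N.N 3) = (sig 3 1 * sig 3 0 * (sig 3 0 ^ 2 * x13) ^ m * f : B 3) := by
  -- the two paths from `(12)3` to `(23)1`
  let o213 : Equiv.Perm (Fin 3) := Equiv.swap 0 1
  let o231 : Equiv.Perm (Fin 3) := finRotate 3
  have e1 : (comb 1).ins 0 (comb 1) = comb 2 := Ob.ext' (by decide) (by decide)
  have e2 : (comb 1).ins 0 ob21 = (comb 2).act o213 := Ob.ext' (by decide) (by decide)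
  have e3 : ((comb 1).ins 1 (comb 1)).act o213 = ob1_23.act o213 :=
    Ob.ext' (by decide) (by decide)
  have e4 : ((comb 1).ins 1 ob21).act o213 = ob1_23.act o231 := Ob.ext' (by decide) (by decide)
  have e5 : (comb 1).ins 1 (comb 1) = ob1_23 := Ob.ext' (by decide) (by decide)
  have e6 : ob21.ins 1 (comb 1) = (comb 2).act o231 := Ob.ext' (by decide) (by decide)
  have p1 := ((hT.assoc.act o231).inv.mul ((hT.place_braiding_one.act o213).congr_ob e3 e4)).mul
    ((hT.assoc.act o213).mul (hT.place_braiding_zero.congr_ob e1 e2))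
  have p2 := (hT.cable_braiding_one.congr_ob e5 e6).mul hT.assoc
  simp only [inv_one, mul_one, one_mul] at p1 p2
  simpa only [mul_assoc] using p1.eq_coset p2

/-- Both paths from ((12)3)4 to 1(2(34)) consist of associators only, so before applying T each has
the trivial braid; their images must coincide. -/
lemma IsT.pentagon (hT : IsT T m f) :
    ((phiSide 1 f * phiDbl 1 f * phiSide 0 f : B 4) : B 4 ⧸ N.N) =
      (phiDbl 2 f * phiDbl 0 f : B 4) := by
  have d0 := hT.assoc.ins_id (comb 1) (by norm_num) (by norm_num) 0
  have d1 := hT.assoc.ins_id (comb 1) (by norm_num) (by norm_num) 1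
  have d2 := hT.assoc.ins_id (comb 1) (by norm_num) (by norm_num) 2
  have s0 := hT.assoc.id_ins (by norm_num) (by norm_num) (comb 1) 0
  have s1 := hT.assoc.id_ins (by norm_num) (by norm_num) (comb 1) 1
  have p1 := (s1.congr_ob (a' := ob1_23.ins 1 (comb 1)) (b' := (comb 1).ins 1 ob1_23)
    (Ob.ext' (by decide) (by decide)) rfl).mul (d1.mul (s0.congr_ob
      (a' := comb 3) (b' := (comb 2).ins 1 (comb 1))
      (Ob.ext' (by decide) (by decide)) (Ob.ext' (by decide) (by decide))))
  have p2 := (d2.congr_ob (a' := ob1_23.ins 0 (comb 1)) (b' := (comb 1).ins 1 ob1_23)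
    (Ob.ext' (by decide) (by decide)) (Ob.ext' (by decide) (by decide))).mul
    (d0.congr_ob (a' := comb 3) (Ob.ext' (by decide) (by decide)) rfl)
  simp only [cable_one, map_one, mul_one] at p1 p2
  have := p1.eq_coset p2
  rw [← mul_assoc] at this
  simp only [phiSide_apply, phiDbl_apply]
  exact this

lemma IsT.isGTPair (hT : IsT T m f) : IsGTPair N m f where
  hexagon₁ := by simpa [sq, mul_assoc] using hT.hexagon_one
  hexagon₂ := by simpa [sq, mul_assoc] using hT.hexagon_two
  pentagon := hT.pentagon

end Relations

/-! ### Surjectivity and kernel of the maps on pure braids -/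

section Automorphisms

variable {N : NFI} {T : Mor eqRel (rel N)} {k : ℕ} {h h' : PB (k + 1)}

lemma TPB_eq_of_sendsTo (hk : k + 1 ≤ 4) (hh : SendsTo T (comb k) (comb k) (h : B (k + 1)) h') :
    TPB T hk h = (h' : PB (k + 1) ⧸ (NPB N.N (k + 1)).subgroupOf (PB (k + 1))) := by
  obtain ⟨_, γ, δ, e1, e2, e⟩ := hh
  obtain rfl : γ = pureHom h := Hom.ext e1
  obtain rfl : δ = pureHom h' := Hom.ext e2
  rw [TPB, e]
  rfl

lemma exists_sendsTo (hk : k + 1 ≤ 4) (T : Mor eqRel (rel N)) (h : PB (k + 1)) :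
    ∃ h' : PB (k + 1), SendsTo T (comb k) (comb k) (h : B (k + 1)) h' := by
  obtain ⟨δ, hδ⟩ := Quotient.exists_rep (T.map hk (eqRel.cls hk (pureHom h)))
  have hp : δ.braid ∈ PB (k + 1) := by
    change rho (k + 1) δ.braid = 1
    rw [δ.rho_braid, inv_mul_cancel]
  exact ⟨⟨δ.braid, hp⟩, hk, pureHom h, δ, rfl, rfl, hδ.symm⟩

lemma toMor_map {N₁ N₂ : GTSh} (T : N₁ ⟶ N₂) {n : ℕ} (hn : n ≤ 4) {a b : Ob n} (γ : GTS.Hom a b) :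
    (GTSh.toMor T).map hn (eqRel.cls hn γ) = T.hom.map hn ((rel N₁).cls hn γ) := rfl

/-- A preimage of the class of h is any braid representing the image of 𝔪(h) under the inverse
isomorphism. -/
lemma TPB_surjective {N₁ N₂ : GTSh} (T : N₁ ⟶ N₂) (hk : k + 1 ≤ 4) :
    Function.Surjective (TPB (GTSh.toMor T) hk) := by
  intro x
  obtain ⟨h, rfl⟩ := QuotientGroup.mk_surjective x
  obtain ⟨γ, hγ⟩ := Quotient.exists_rep (T.inv.map hk ((rel N₂).cls hk (pureHom h)))
  have hp : γ.braid ∈ PB (k + 1) := by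
    change rho (k + 1) γ.braid = 1
    rw [γ.rho_braid, inv_mul_cancel]
  have hid : T.hom.map hk (T.inv.map hk ((rel N₂).cls hk (pureHom h))) =
      (rel N₂).cls hk (pureHom h) :=
    congrArg (fun U : Mor (rel N₂) (rel N₂) => U.map hk ((rel N₂).cls hk (pureHom h)))
      T.inv_hom_id
  rw [← hγ] at hid
  exact ⟨⟨γ.braid, hp⟩, TPB_eq_of_sendsTo hk ⟨hk, γ, pureHom h, rfl, rfl, hid⟩⟩

lemma TPB_eq_one_iff {N₁ N₂ : GTSh} (T : N₁ ⟶ N₂) (hk : k + 1 ≤ 4) (h : PB (k + 1)) :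
    TPB (GTSh.toMor T) hk h = 1 ↔ (h : B (k + 1)) ∈ NPB N₁.N (k + 1) := by
  have hinj : ∀ x : (rel N₁).Q hk (comb k) (comb k), T.inv.map hk (T.hom.map hk x) = x := fun x =>
    congrArg (fun U : Mor (rel N₁) (rel N₁) => U.map hk x) T.hom_inv_id
  constructor
  · intro e
    obtain ⟨h', hh⟩ := exists_sendsTo hk (GTSh.toMor T) h
    rw [TPB_eq_of_sendsTo hk hh] at e
    obtain ⟨_, γ, δ, e1, e2, e3⟩ := hh
    obtain rfl : γ = pureHom h := Hom.ext e1
    obtain rfl : δ = pureHom h' := Hom.ext e2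
    have h1 : (rel N₂).cls hk (Hom.id (comb k)) = (rel N₂).cls hk (pureHom h') := by
      refine Quotient.sound ?_
      change (1 : B (k + 1))⁻¹ * h' ∈ _
      have h2 : h' ∈ (NPB N₂.N (k + 1)).subgroupOf (PB (k + 1)) := (QuotientGroup.eq_one_iff h').1 e
      rw [inv_one, one_mul]
      exact Subgroup.mem_subgroupOf.1 h2
    -- The images of 𝔪(h) and of the identity under T now agree; the inverse isomorphism carries
    -- this back to an equivalence modulo the subgroup attached to N₁.
    rw [← h1, ← (GTSh.toMor T).map_id, toMor_map, toMor_map] at e3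
    have h3 := congrArg (T.inv.map hk) e3
    rw [hinj, hinj] at h3
    have h4 := (NPB N₁.N (k + 1)).inv_mem (Quotient.exact h3)
    simpa [Hom.id, pureHom] using h4
  · intro hh
    have h1 : (rel N₁).cls hk (pureHom h) = (rel N₁).cls hk (Hom.id (comb k)) := by
      refine Quotient.sound ?_
      change (h : B (k + 1))⁻¹ * 1 ∈ _
      simpa using hh
    refine TPB_eq_of_sendsTo hk (h' := 1) ⟨hk, pureHom h, Hom.id _, rfl, rfl, ?_⟩
    rw [toMor_map, h1]
    exact T.hom.map_id hk _

/-- The morphism T itself serves as T_{m,f}, so no existence theorem for morphisms out of PaB is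
needed. -/
lemma IsT.isGTShadow {N₁ N₂ : GTSh} {T : N₁ ⟶ N₂} {m : ℤ} {f : PB 3}
    (hT : GTSh.Represents T m f) : IsGTShadow N₂ m f :=
  ⟨IsT.isGTPair hT, GTSh.toMor T, hT, TPB_surjective T _, TPB_surjective T _, TPB_surjective T _⟩

end Automorphisms

/-! ### The composition formula -/

section Composition

lemma SendsTo.comp {R S W : CompatRel} {T : Mor R S} {U : Mor S W} {V : Mor R W}
    (hV : ∀ {n : ℕ} (hn : n ≤ 4) {a b : Ob n} (x : R.Q hn a b), V.map hn x = U.map hn (T.map hn x))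
    {n : ℕ} {a b : Ob n} {g g' g'' : B n} (h : SendsTo T a b g g') (h' : SendsTo U a b g' g'') :
    SendsTo V a b g g'' := by
  obtain ⟨hn, γ, δ, rfl, rfl, e⟩ := h
  obtain ⟨_, δ', ε, e1, rfl, e'⟩ := h'
  obtain rfl : δ' = δ := Hom.ext e1
  exact ⟨hn, γ, ε, rfl, rfl, by rw [hV, e, e']⟩

lemma sendsTo_toMor_comp {N₁ N₂ N₃ : GTSh} {T₁ : N₁ ⟶ N₂} {T₂ : N₂ ⟶ N₃} {n : ℕ} {a b : Ob n}
    {g g' g'' : B n} (h : SendsTo (GTSh.toMor T₁) a b g g')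
    (h' : SendsTo (GTSh.toMor T₂) a b g' g'') :
    SendsTo (GTSh.toMor (T₁ ≫ T₂)) a b g g'' :=
  -- Projecting the class of γ gives the class of γ by definition, so a statement about `GTSh.toMor
  -- T₂` serves as one about `T₂.hom`.
  SendsTo.comp (U := T₂.hom) (fun _ _ _ _ => rfl) h h'

/-- Lets f be any representative of its coset. The factor g' need not be pure; it cancels in
(g'h)⁻¹g'h' = h⁻¹h'. -/
lemma SendsTo.of_coset_eq {R : CompatRel} {N : NFI} {T : Mor R (rel N)} {n : ℕ} {a b : Ob n}
    {g g' : B n} {h h' : PB n} (hg : SendsTo T a b g (g' * h))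
    (e : (h : PB n ⧸ (NPB N.N n).subgroupOf (PB n)) = h') : SendsTo T a b g (g' * h') := by
  obtain ⟨hn, γ, δ, rfl, e2, e'⟩ := hg
  have e3 : (h : B n)⁻¹ * h' ∈ NPB N.N n := Subgroup.mem_subgroupOf.1 (QuotientGroup.eq.1 e)
  refine ⟨hn, γ, ⟨g' * h', ?_⟩, rfl, rfl, e'.trans (Quotient.sound ?_)⟩
  · rw [← δ.rho_braid, e2, map_mul, map_mul, rho_pure, rho_pure]
  · change δ.braid⁻¹ * (g' * h') ∈ _
    rw [e2]
    simpa [mul_assoc] using e3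

variable {N₁ N₂ N₃ : GTSh} {T₁ : N₁ ⟶ N₂} {T₂ : N₂ ⟶ N₃} {m₁ m₂ : ℤ} {f₁ f₂ : PB 3}

lemma represents_comp (h₁ : GTSh.Represents T₁ m₁ f₁) (h₂ : GTSh.Represents T₂ m₂ f₂) {f : PB 3}
    (hf : (f : PB 3 ⧸ (NPB N₃.N 3).subgroupOf (PB 3)) =
      (f₂ : PB 3 ⧸ (NPB N₃.N 3).subgroupOf (PB 3)) * TPB3 (GTSh.toMor T₂) f₁) :
    GTSh.Represents (T₁ ≫ T₂) (2 * m₁ * m₂ + m₁ + m₂) f := by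
  refine IsT.of_sendsTo ?_ ?_
  · obtain ⟨f', hf'⟩ := exists_sendsTo (k := 2) (by norm_num) (GTSh.toMor T₂) f₁
    rw [TPB3, TPB_eq_of_sendsTo _ hf'] at hf
    have h := (IsT.assoc h₂).mul hf'
    -- The image is brought to the form g'·h with g' = 1 and h = f₂f' pure, where f' represents
    -- T₂^{PB₃}(f₁).
    rw [one_mul, ← Subgroup.coe_mul, ← one_mul ((f₂ * f' : PB 3) : B 3)] at h
    simpa using sendsTo_toMor_comp (IsT.assoc h₁) (h.of_coset_eq hf.symm)
  · convert sendsTo_toMor_comp (IsT.braiding h₁)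
      ((IsT.braiding h₂).mul ((IsT.sq_two h₂).zpow m₁)) using 1
    -- What remains is the exponent identity m₂ + (2m₂+1)m₁ = 2m₁m₂ + m₁ + m₂ for powers of σ₁².
    rw [← zpow_mul]
    refine Eq.trans (congrArg (sig 2 0 * ·) ?_) (mul_assoc _ _ _).symm
    refine Eq.trans ?_ (zpow_add (sig 2 0 ^ 2) m₂ ((2 * m₂ + 1) * m₁))
    congr 1
    ring

/-- The values on x₁₂ and x₂₃ are known, and `SendsTo` is stable under products and inverses, so
induction on the word gives the substitution. -/
lemma IsT.evalXY {N : NFI} {T : Mor eqRel (rel N)} {m : ℤ} {w₂ : FreeGroup (Fin 2)}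
    (hT : IsT T m (GTS.evalXY w₂)) (w : FreeGroup (Fin 2)) :
    SendsTo T (comb 2) (comb 2) (GTS.evalXY w : B 3)
      (GTS.evalXY (FreeGroup.lift
        ![FreeGroup.of 0 ^ (2 * m + 1), w₂⁻¹ * FreeGroup.of 1 ^ (2 * m + 1) * w₂] w)) := by
  induction w using FreeGroup.induction_on with
  | C1 => simpa using SendsTo.one (by norm_num) _
  | of i =>
    fin_cases i
    · simpa [GTS.evalXY, sq] using hT.sq_three_zero
    · simpa [GTS.evalXY, sq] using hT.sq_three_one
  | inv_of i h => simpa only [map_inv, Subgroup.coe_inv] using h.inv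
  | mul x y hx hy => simpa only [map_mul, Subgroup.coe_mul] using hx.mul hy

end Composition

end GTS

/-! ### The proposition -/

theorem proposition2p12 (N₁ N₂ N₃ : GTSh) (T₁ : N₁ ⟶ N₂) (T₂ : N₂ ⟶ N₃) (m₁ m₂ : ℤ) (f₁ f₂ : PB 3)
    (h₁ : GTSh.Represents T₁ m₁ f₁) (h₂ : GTSh.Represents T₂ m₂ f₂) :
    (∀ f : PB 3,
      (f : PB 3 ⧸ (NPB N₃.N 3).subgroupOf (PB 3)) =
          (f₂ : PB 3 ⧸ (NPB N₃.N 3).subgroupOf (PB 3)) *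
            TPB3 (GTSh.toMor T₂) f₁ →
        GTSh.Represents (T₁ ≫ T₂) (2 * m₁ * m₂ + m₁ + m₂) f ∧
          IsGTShadow N₃ (2 * m₁ * m₂ + m₁ + m₂) f ∧
          ∀ h : PB 4, TPB4 (GTSh.toMor (T₁ ≫ T₂)) h = 1 ↔ (h : B 4) ∈ N₁.N) ∧
    (∀ w₁ w₂ : FreeGroup (Fin 2), f₁ = evalXY w₁ → f₂ = evalXY w₂ →
      GTSh.Represents (T₁ ≫ T₂) (2 * m₁ * m₂ + m₁ + m₂)
        (evalXY (w₂ * FreeGroup.lift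
          ![FreeGroup.of 0 ^ (2 * m₂ + 1), w₂⁻¹ * FreeGroup.of 1 ^ (2 * m₂ + 1) * w₂] w₁))) := by
  refine ⟨fun f hf => ?_, ?_⟩
  · have h := represents_comp h₁ h₂ hf
    exact ⟨h, IsT.isGTShadow h, TPB_eq_one_iff (T₁ ≫ T₂) _⟩
  · rintro w₁ w₂ rfl rfl
    refine represents_comp h₁ h₂ ?_
    -- The word formula is a case of the general one: the substituted word represents T₂^{PB₃}(f₁),
    -- and cosets multiply through representatives.
    rw [TPB3, TPB_eq_of_sendsTo _ (IsT.evalXY h₂ w₁), map_mul]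
    rfl
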